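/- **Theorem 2.5.** Let \(k\) be a field of characteristic \(0\), let \(m \ge 0\), and let \(\mathrm{FI}^m\) be the category whose objects are \(m\)-tuples \(\mathbf d = (d_1,\dots,d_m)\) of finite sets and whose morphisms are \(m\)-tuples of injections. An \(\mathrm{FI}^m\)-module is a functor \(V : \mathrm{FI}^m \to k\text{-Mod}\), \(\mathbf d \mapsto V_{\mathbf d}\); it is finitely generated if it has finitely many elements that lie in no proper submodule. For an object \(\mathbf a\), the shift \(S_{+\mathbf a}V\) is the \(\mathrm{FI}^m\)-module \(\mathbf d \mapsto V_{\mathbf d + \mathbf a}\), where \(\mathbf d + \mathbf a\) is the componentwise disjoint union, and \(M(\mathbf c) = k[\mathrm{Hom}_{\mathrm{FI}^m}(\mathbf c, -)]\). An \(\mathrm{FI}^m\)-module \(V\) is called filtered if there is a surjection \(\Pi : \bigoplus_{i=1}^g M(\mathbf d_i) \to V\), for some \(g \ge 0\) and some objects \(\mathbf d_1,\dots,\mathbf d_g\), such that the filtration \(0 = V^0 \subseteq V^1 \subseteq \dots \subseteq V^g = V\) given by \(V^r = \Pi\bigl(\bigoplus_{i=1}^r M(\mathbf d_i)\bigr)\)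 has successive quotients \(V^r/V^{r-1}\), \(1 \le r \le g\), that are projective \(\mathrm{FI}^m\)-modules. Let \(V\) be a finitely generated \(\mathrm{FI}^m\)-module. Then there is an object \(\mathbf a\) of \(\mathrm{FI}^m\) such that \(S_{+\mathbf a}V\) is filtered. Furthermore, there are an integer \(N \ge 0\), filtered \(\mathrm{FI}^m\)-modules \(J^0,\dots,J^N\) and a complex of \(\mathrm{FI}^m\)-modules \[ 0 \to V \to J^0 \to \cdots \to J^N \to 0 \] that is exact in all sufficiently large degrees: there is \(D \in \mathbb N^m\) such that the sequence \[ 0 \to V_{\mathbf d} \to J^0_{\mathbf d} \to \cdots \to J^N_{\mathbf d} \to 0 \] is exact for every \(\mathbf d\) with \(|d_i| \ge D_i\) for all \(i\). -/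

import Mathlib

open CategoryTheory CategoryTheory.Limits

universe u

noncomputable section

/-- An object of the category FI: a finite set. -/
structure FI : Type 1 where
  /-- The underlying finite set. -/
  carrier : Type
  [finite : Finite carrier]

namespace FI

attribute [instance] FI.finite

/-- The morphisms of FI are the injections. -/
instance : Category.{0} FI where
  Hom S T := S.carrier ↪ T.carrier
  id S := Function.Embedding.refl S.carrier
  comp f g := Function.Embedding.trans f g

/-- The disjoint union of two finite sets. -/
def add (S T : FI) : FI := ⟨S.carrier ⊕ T.carrier⟩

/-- The injection `f ⊔ id : S ⊔ A → T ⊔ A` induced by an injection `f : S → T`. -/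
def addMap {S T : FI} (f : S ⟶ T) (A : FI) : S.add A ⟶ T.add A :=
  Function.Embedding.sumMap (show S.carrier ↪ T.carrier from f)
    (Function.Embedding.refl A.carrier)

end FI

/-- The category `FI^m`: the `m`-fold product of FI with itself.  Its objects are the `m`-tuples of
finite sets and its morphisms the `m`-tuples of injections. -/
abbrev FIPow (m : ℕ) : Type 1 := Fin m → FI

namespace FIPow

/-- The multidegree of a tuple of finite sets: the tuple of the cardinalities. -/
def card {m : ℕ} (d : FIPow m) : Fin m → ℕ := fun i => Nat.card (d i).carrier

/-- The functor `d ↦ d + a` (componentwise disjoint union with `a`) from `FI^m` to itself. -/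
def addFunctor {m : ℕ} (a : FIPow m) : FIPow m ⥤ FIPow m where
  obj d := fun i => (d i).add (a i)
  map f := fun i => FI.addMap (f i) (a i)
  map_id d := by
    funext i
    apply Function.Embedding.ext
    rintro (x | x) <;> rfl
  map_comp f g := by
    funext i
    apply Function.Embedding.ext
    rintro (x | x) <;> rfl

end FIPow

/-- `FI^m`-modules over `k`: functors from `FI^m` to `k`-modules, with natural transformations
as morphisms. -/
abbrev FIPowModule (k : Type u) [Field k] (m : ℕ) := FIPow m ⥤ ModuleCat.{u} k

namespace FIPowModule

variable {k : Type u} [Field k] {m : ℕ}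

/-- The shift `S_{+a} V`, with `(S_{+a} V)_d = V_{d + a}`. -/
def shift (a : FIPow m) (V : FIPowModule k m) : FIPowModule k m :=
  FIPow.addFunctor a ⋙ V

variable (k) in
/-- The free module `M(c) = k[Hom(c, -)]`. -/
def free (c : FIPow m) : FIPowModule k m where
  obj d := ModuleCat.of k ((c ⟶ d) →₀ k)
  map f := ModuleCat.ofHom (Finsupp.lmapDomain k k (fun h => h ≫ f))
  map_id d := by
    ext1
    exact Finsupp.lmapDomain_id k k
  map_comp f g := by
    ext1
    simp only [ModuleCat.hom_comp, ModuleCat.hom_ofHom]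
    rw [← Finsupp.lmapDomain_comp]
    congr 1

/-- A submodule of an `FI^m`-module. -/
structure Sub (V : FIPowModule k m) where
  /-- The part of the submodule in each degree. -/
  carrier : ∀ d : FIPow m, Submodule k (V.obj d)
  /-- The parts are preserved by the maps induced by morphisms of `FI^m`. -/
  map_mem : ∀ {d e : FIPow m} (f : d ⟶ e) {x : V.obj d},
    x ∈ carrier d → (V.map f).hom x ∈ carrier e

/-- An `FI^m`-module is finitely generated if there are finitely many elements such that the only
submodule containing them is the whole module. -/
def IsFinitelyGenerated (V : FIPowModule k m) : Prop :=
  ∃ (n : ℕ) (d : Fin n → FIPow m) (v : ∀ i, V.obj (d i)),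
    ∀ W : Sub V, (∀ i, v i ∈ W.carrier (d i)) → ∀ e, W.carrier e = ⊤

/-- The image of a morphism of `FI^m`-modules, as a submodule of the target. -/
def range {U V : FIPowModule k m} (φ : U ⟶ V) : Sub V where
  carrier d := LinearMap.range (φ.app d).hom
  map_mem := by
    rintro d e f _ ⟨x, rfl⟩
    exact ⟨(U.map f).hom x, NatTrans.naturality_apply φ f x⟩

/-- The quotient `W / (W ∩ W')` for two submodules `W'` and `W` of an `FI^m`-module.  It is used
only for `W' ⊆ W`, where it is `W / W'`. -/
def subquotient {V : FIPowModule k m} (W W' : Sub V) : FIPowModule k m where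
  obj d := ModuleCat.of k (W.carrier d ⧸ (W'.carrier d).submoduleOf (W.carrier d))
  map {d e} f := ModuleCat.ofHom
    (Submodule.mapQ ((W'.carrier d).submoduleOf (W.carrier d))
      ((W'.carrier e).submoduleOf (W.carrier e))
      ((V.map f).hom.restrict (fun _ hx => W.map_mem f hx))
      (fun _ hx => W'.map_mem f hx))
  map_id d := by
    ext1
    apply Submodule.linearMap_qext
    ext x
    simp
    rfl
  map_comp f g := by
    ext1
    apply Submodule.linearMap_qext
    ext x
    simp
    rfl

/-- Finite direct sums of `FI^m`-modules exist. -/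
instance : HasFiniteBiproducts (FIPowModule k m) :=
  Abelian.hasFiniteBiproducts

/-- For `Π : M(d_1) ⊕ ⋯ ⊕ M(d_g) → V`, the submodule `V^r = Π(M(d_1) ⊕ ⋯ ⊕ M(d_r))` of `V`. -/
def filtrationStep {V : FIPowModule k m} {g : ℕ} {d : Fin g → FIPow m}
    (P : (⨁ fun i => free k (d i)) ⟶ V) (r : ℕ) : Sub V :=
  range (biproduct.fromSubtype (fun i => free k (d i)) (fun i : Fin g => (i : ℕ) < r) ≫ P)

/-- An `FI^m`-module `V` is filtered if there is a surjection `Π : M(d_1) ⊕ ⋯ ⊕ M(d_g) → V` such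
that the successive quotients `V^{r+1} / V^r` of the filtration `0 = V^0 ⊆ V^1 ⊆ ⋯ ⊆ V^g = V` by the
submodules `V^r = Π(M(d_1) ⊕ ⋯ ⊕ M(d_r))` are projective `FI^m`-modules. -/
def IsFiltered (V : FIPowModule k m) : Prop :=
  ∃ (g : ℕ) (d : Fin g → FIPow m) (P : (⨁ fun i => free k (d i)) ⟶ V),
    (∀ e, Function.Surjective (P.app e)) ∧
      ∀ r < g, Projective (subquotient (filtrationStep P (r + 1)) (filtrationStep P r))

end FIPowModule

end

/-! Everything rests on one observation: an injection `c → d + a` that meets `a` restricts to an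
injection from a proper subset of `c` into `d`. Hence `S_{+a}V` is the sum of the image of `V` and a
submodule `newPart` generated in strictly smaller degrees (`exists_add_of_shift`,
`genBelow_newPart`). This allows induction on the degree of generation.

Some shift of V is projective. For V cyclic with generator in degree `c`, the quotient `S_{+a}V /
newPart` is a quotient of `M(c)`. The relations of V, restricted along injections out of `c`, form
subspaces of the finite-dimensional space `k[End c]`, and for suitable `a` they have stopped
growing. Then the kernel from `M(c)` is governed by its part in degree `c`, and averaging as in
Maschke's theorem (`projective_of_pull_mem`, where characteristic zero enters) makes the quotient
projective. A further shift makes `newPart` projective by induction, and extensions of projectives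
split. Several generators are handled one at a time, since shifts commute and preserve projectivity
of finitely generated modules.

A finitely generated projective module is filtered once its generators are sorted by degree:
morphisms `M(b) → M(c)` with `deg b ≤ deg c` commute with restriction (`app_pull`), so the averaging
criterion applies to each successive quotient (`projective_of_ker_eq`).

For the complex, `V → S_{+a}V` is injective in large degrees when `S_{+a}V` is projective, and its
cokernel is a quotient of `newPart`. Induction resolves the cokernel, and the two pieces are
spliced. -/

noncomputable section

/-! ### Tuples of injections: amalgamation and factorisation of maps into `d + a` -/

namespace FIPow

variable {m : ℕ}

instance (c d : FIPow m) : Finite (c ⟶ d) :=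
  inferInstanceAs (Finite (∀ i, (c i).carrier ↪ (d i).carrier))

instance (c d : FIPow m) : Fintype (c ⟶ d) := Fintype.ofFinite _

/-- The underlying map of a component of a morphism of `FI^m`. -/
def fn {c d : FIPow m} (f : c ⟶ d) (i : Fin m) : (c i).carrier → (d i).carrier :=
  (show (c i).carrier ↪ (d i).carrier from f i)

theorem fn_injective {c d : FIPow m} (f : c ⟶ d) (i : Fin m) : Function.Injective (fn f i) :=
  (show (c i).carrier ↪ (d i).carrier from f i).injective

theorem hom_ext {c d : FIPow m} {f g : c ⟶ d} (h : ∀ i x, fn f i x = fn g i x) : f = g := by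
  funext i
  exact Function.Embedding.ext (h i)

@[simp] theorem fn_comp {c d e : FIPow m} (f : c ⟶ d) (g : d ⟶ e) (i : Fin m)
    (x : (c i).carrier) : fn (f ≫ g) i x = fn g i (fn f i x) := rfl

/-- A morphism of `FI^m` given by a family of injective maps. -/
def homMk {c d : FIPow m} (f : ∀ i, (c i).carrier → (d i).carrier)
    (hf : ∀ i, Function.Injective (f i)) : c ⟶ d :=
  fun i => (⟨f i, hf i⟩ : (c i).carrier ↪ (d i).carrier)

theorem comp_right_injective {c d e : FIPow m} (f : d ⟶ e) :
    Function.Injective (fun h : c ⟶ d => h ≫ f) := by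
  intro g h hgh
  refine hom_ext fun i x => fn_injective f i ?_
  exact congrArg (fun q : c ⟶ e => fn q i x) hgh

/-- The total degree of an object of `FI^m`. -/
def deg (c : FIPow m) : ℕ := ∑ i, card c i

/-- Injections make each cardinality grow, so equality of the sums forces equality in every
component. In particular endomorphisms are invertible. -/
theorem exists_inv_of_deg_le {c d : FIPow m} (f : c ⟶ d) (h : deg d ≤ deg c) :
    ∃ g : d ⟶ c, f ≫ g = 𝟙 c ∧ g ≫ f = 𝟙 d := by
  have hle : ∀ i ∈ Finset.univ, card c i ≤ card d i := fun i _ =>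
    Nat.card_le_card_of_injective (fn f i) (fn_injective f i)
  have heq := (Finset.sum_eq_sum_iff_of_le hle).1 (le_antisymm (Finset.sum_le_sum hle) h)
  have hb : ∀ i, Function.Bijective (fn f i) := fun i =>
    (fn_injective f i).bijective_of_nat_card_le (heq i (Finset.mem_univ i)).ge
  let e : ∀ i, (c i).carrier ≃ (d i).carrier := fun i => Equiv.ofBijective _ (hb i)
  refine ⟨homMk (fun i => (e i).symm) (fun i => (e i).symm.injective), ?_, ?_⟩
  · exact hom_ext fun i x => (e i).symm_apply_apply x
  · exact hom_ext fun i x => (e i).apply_symm_apply x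

/-- The disjoint union of two objects of `FI^m`. -/
abbrev add (d a : FIPow m) : FIPow m := (addFunctor a).obj d

/-- The inclusion of `d` into `d + a`. -/
def inl (d a : FIPow m) : d ⟶ add d a := homMk (fun _ x => Sum.inl x) (fun _ => Sum.inl_injective)

/-- The morphism `f + a`. -/
abbrev addMap {d e : FIPow m} (f : d ⟶ e) (a : FIPow m) : add d a ⟶ add e a := (addFunctor a).map f

@[simp] theorem fn_inl (d a : FIPow m) (i : Fin m) (x : (d i).carrier) :
    fn (inl d a) i x = Sum.inl x := rfl

@[simp] theorem fn_addMap_inr {d e : FIPow m} (f : d ⟶ e) (a : FIPow m) (i : Fin m)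
    (x : (a i).carrier) : fn (addMap f a) i (Sum.inr x) = Sum.inr x := rfl

theorem inl_naturality {d e : FIPow m} (f : d ⟶ e) (a : FIPow m) :
    inl d a ≫ addMap f a = f ≫ inl e a := rfl

/-- Two morphisms out of the same object can be amalgamated; the first leg is the inclusion into a
disjoint union. -/
theorem exists_amalgam {c d e : FIPow m} (f : c ⟶ d) (g : c ⟶ e) :
    ∃ h : e ⟶ add d e, g ≫ h = f ≫ inl d e := by
  classical
  let F : ∀ i, (e i).carrier → (d i).carrier ⊕ (e i).carrier := fun i y =>
    if hy : ∃ x, fn g i x = y then Sum.inl (fn f i hy.choose) else Sum.inr y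
  have F_inl : ∀ i x, F i (fn g i x) = Sum.inl (fn f i x) := by
    intro i x
    have hx : ∃ x', fn g i x' = fn g i x := ⟨x, rfl⟩
    refine (dif_pos hx).trans ?_
    rw [fn_injective g i hx.choose_spec]
  have F_inr : ∀ i y, (¬ ∃ x, fn g i x = y) → F i y = Sum.inr y := fun i y hy => dif_neg hy
  refine ⟨homMk F fun i y y' hyy => ?_, hom_ext F_inl⟩
  by_cases hy : ∃ x, fn g i x = y <;> by_cases hy' : ∃ x, fn g i x = y'
  · obtain ⟨x, rfl⟩ := hy
    obtain ⟨x', rfl⟩ := hy'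
    rw [F_inl, F_inl] at hyy
    rw [fn_injective f i (Sum.inl_injective hyy)]
  · obtain ⟨x, rfl⟩ := hy
    rw [F_inl, F_inr i y' hy'] at hyy
    cases hyy
  · obtain ⟨x, rfl⟩ := hy'
    rw [F_inl, F_inr i y hy] at hyy
    cases hyy
  · rw [F_inr i y hy, F_inr i y' hy'] at hyy
    exact Sum.inr_injective hyy

/-- The object of `FI^m` given by a tuple of subsets. -/
def ofSets {c : FIPow m} (s : ∀ i, Set (c i).carrier) : FIPow m := fun i => ⟨s i⟩

theorem deg_ofSets_lt {c : FIPow m} (s : ∀ i, Set (c i).carrier) (h : ∃ i x, x ∉ s i) :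
    deg (ofSets s) < deg c := by
  obtain ⟨i, x, hx⟩ := h
  refine Finset.sum_lt_sum (fun j _ => Nat.card_le_card_of_injective _ Subtype.val_injective)
    ⟨i, Finset.mem_univ i, ?_⟩
  exact Finite.card_subtype_lt hx

/-- A morphism `h : c ⟶ s + a`, for a tuple `s` of subsets of `c`, is canonical if it is the
inclusion on `s` and maps the complement of `s` to `a`. -/
def IsCanonical {c a : FIPow m} (s : ∀ i, Set (c i).carrier) (h : c ⟶ add (ofSets s) a) : Prop :=
  ∀ i x, (∀ hx : x ∈ s i, fn h i x = Sum.inl ⟨x, hx⟩) ∧ (x ∉ s i → ∃ y, fn h i x = Sum.inr y)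

/-- Take for `s` the points of `c` that land in `d`. For fixed `c` and `a` there are only finitely
many pairs `(s, h₀)`, whatever `d` is. -/
theorem exists_canonical {c d a : FIPow m} (h : c ⟶ add d a) :
    ∃ (s : ∀ i, Set (c i).carrier) (h₀ : c ⟶ add (ofSets s) a) (g : ofSets s ⟶ d),
      IsCanonical s h₀ ∧ h₀ ≫ addMap g a = h := by
  classical
  let s : ∀ i, Set (c i).carrier := fun i => {x | ∃ y : (d i).carrier, fn h i x = Sum.inl y}
  have hs : ∀ i x, x ∉ s i → ∃ y : (a i).carrier, fn h i x = Sum.inr y := by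
    intro i x hx
    rcases hy : fn h i x with y | y
    · exact absurd ⟨y, hy⟩ hx
    · exact ⟨y, rfl⟩
  let G : ∀ i, (ofSets s i).carrier → (d i).carrier := fun i x => x.2.choose
  have hG : ∀ i (x : (ofSets s i).carrier), fn h i x.1 = Sum.inl (G i x) := fun i x =>
    x.2.choose_spec
  let H : ∀ i, (c i).carrier → (s i) ⊕ (a i).carrier := fun i x =>
    if hx : x ∈ s i then Sum.inl ⟨x, hx⟩ else Sum.inr (hs i x hx).choose
  have H_inl : ∀ i x (hx : x ∈ s i), H i x = Sum.inl ⟨x, hx⟩ := fun i x hx => dif_pos hx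
  have H_inr : ∀ i x (hx : x ∉ s i), H i x = Sum.inr (hs i x hx).choose := fun i x hx => dif_neg hx
  have hH : ∀ i x, Sum.map (G i) id (H i x) = fn h i x := by
    intro i x
    by_cases hx : x ∈ s i
    · rw [H_inl i x hx]
      exact (hG i ⟨x, hx⟩).symm
    · rw [H_inr i x hx]
      exact (hs i x hx).choose_spec.symm
  refine ⟨s, homMk H fun i x x' hxx => ?_, homMk G fun i x x' hxx => ?_, fun i x => ⟨?_, ?_⟩,
    hom_ext hH⟩
  · exact fn_injective h i (by rw [← hH, ← hH, hxx])
  · exact Subtype.ext (fn_injective h i (by rw [hG, hG, hxx]))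
  · exact H_inl i x
  · exact fun hx => ⟨_, H_inr i x hx⟩

/-- The set `s` is recovered as the preimage of the left summand, and then `h₀` and `g₀` are
determined. The types of these two depend on `s`, so uniqueness is expressed through an arbitrary
function `Ψ` of the triple. -/
theorem canonical_unique {c d a : FIPow m} {s t : ∀ i, Set (c i).carrier}
    {h₀ : c ⟶ add (ofSets s) a} {h₁ : c ⟶ add (ofSets t) a} {g₀ : ofSets s ⟶ d}
    {g₁ : ofSets t ⟶ d} (hs : IsCanonical s h₀) (ht : IsCanonical t h₁)
    (h : h₀ ≫ addMap g₀ a = h₁ ≫ addMap g₁ a) {β : Type*}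
    (Ψ : ∀ s : ∀ i, Set (c i).carrier, (c ⟶ add (ofSets s) a) → (ofSets s ⟶ d) → β) :
    Ψ s h₀ g₀ = Ψ t h₁ g₁ := by
  have key : ∀ i x, fn (addMap g₀ a) i (fn h₀ i x) = fn (addMap g₁ a) i (fn h₁ i x) :=
    fun i x => congrArg (fun q : c ⟶ add d a => fn q i x) h
  have hst : s = t := by
    funext i
    ext x
    have := key i x
    constructor
    · intro hx
      by_contra hx'
      obtain ⟨y, hy⟩ := (ht i x).2 hx'
      rw [(hs i x).1 hx, hy] at this
      cases this
    · intro hx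
      by_contra hx'
      obtain ⟨y, hy⟩ := (hs i x).2 hx'
      rw [(ht i x).1 hx, hy] at this
      cases this
  subst hst
  congr 1 <;> refine hom_ext fun i x => ?_
  · by_cases hx : x ∈ s i
    · exact ((hs i x).1 hx).trans ((ht i x).1 hx).symm
    · obtain ⟨y, hy⟩ := (hs i x).2 hx
      obtain ⟨z, hz⟩ := (ht i x).2 hx
      have := key i x
      rw [hy, hz] at this
      show fn h₀ i x = fn h₁ i x
      rw [hy, hz]
      exact congrArg _ (Sum.inr_injective this)
  · have := key i x.1
    rw [(hs i x.1).1 x.2, (ht i x.1).1 x.2] at this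
    exact Sum.inl_injective this

end FIPow

/-! ### Submodules, quotients and splitting off projective quotients -/

namespace FIPowModule

variable {k : Type u} [Field k] {m : ℕ}

section Basic

variable {U V C : FIPowModule k m}

theorem map_comp_apply (V : FIPowModule k m) {c d e : FIPow m} (f : c ⟶ d) (g : d ⟶ e)
    (x : V.obj c) : (V.map (f ≫ g)).hom x = (V.map g).hom ((V.map f).hom x) := by
  rw [V.map_comp]
  rfl

theorem map_id_apply (V : FIPowModule k m) {c : FIPow m} (x : V.obj c) :
    (V.map (𝟙 c)).hom x = x := by
  rw [V.map_id]
  rfl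

theorem app_map (φ : U ⟶ V) {d e : FIPow m} (f : d ⟶ e) (x : U.obj d) :
    (φ.app e).hom ((U.map f).hom x) = (V.map f).hom ((φ.app d).hom x) :=
  NatTrans.naturality_apply φ f x

theorem comp_app_apply (φ : U ⟶ V) (ψ : V ⟶ C) (d : FIPow m) (x : U.obj d) :
    ((φ ≫ ψ).app d).hom x = (ψ.app d).hom ((φ.app d).hom x) := rfl

theorem hom_ext {φ ψ : U ⟶ V} (h : ∀ d x, (φ.app d).hom x = (ψ.app d).hom x) : φ = ψ := by
  ext d x
  exact h d x

theorem app_congr {φ ψ : U ⟶ V} (h : φ = ψ) (d : FIPow m) (x : U.obj d) :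
    (φ.app d).hom x = (ψ.app d).hom x := by rw [h]

/-- A morphism of `FI^m`-modules that is surjective in every degree. -/
def Surj (φ : U ⟶ V) : Prop := ∀ d, Function.Surjective (φ.app d).hom

theorem epi_iff_surj (φ : U ⟶ V) : Epi φ ↔ Surj φ := by
  rw [NatTrans.epi_iff_epi_app]
  exact forall_congr' fun d => ModuleCat.epi_iff_surjective _

theorem exists_section [Projective C] {g : V ⟶ C} (hg : Surj g) : ∃ s : C ⟶ V, s ≫ g = 𝟙 C := by
  have := (epi_iff_surj g).2 hg
  exact ⟨Projective.factorThru (𝟙 C) g, Projective.factorThru_comp _ _⟩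

theorem projective_of_retract [Projective V] (i : C ⟶ V) (p : V ⟶ C) (h : i ≫ p = 𝟙 C) :
    Projective C := (Retract.mk i p h).projective

/-- Morphisms that kill the kernel of a surjection factor through it. -/
theorem exists_desc {g : V ⟶ C} (hg : Surj g) (t : V ⟶ U)
    (ht : ∀ d x, (g.app d).hom x = 0 → (t.app d).hom x = 0) : ∃ s : C ⟶ U, g ≫ s = t := by
  let s : ∀ d, C.obj d →ₗ[k] U.obj d := fun d =>
    ((LinearMap.ker (g.app d).hom).liftQ (t.app d).hom fun x hx => ht d x hx) ∘ₗ
      ((g.app d).hom.quotKerEquivOfSurjective (hg d)).symm.toLinearMap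
  have hs : ∀ d x, s d ((g.app d).hom x) = (t.app d).hom x := by
    intro d x
    have : ((g.app d).hom.quotKerEquivOfSurjective (hg d)).symm ((g.app d).hom x)
        = (LinearMap.ker (g.app d).hom).mkQ x := by
      rw [LinearEquiv.symm_apply_eq]
      rfl
    simp only [s, LinearMap.comp_apply, LinearEquiv.coe_coe, this]
    rfl
  refine ⟨{ app := fun d => ModuleCat.ofHom (s d), naturality := fun d e f => ?_ },
    hom_ext fun d x => hs d x⟩
  ext y
  obtain ⟨x, rfl⟩ := hg d y
  change s e ((C.map f).hom _) = (U.map f).hom (s d _)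
  rw [hs, ← app_map, hs, app_map]

end Basic

namespace Sub

variable {U V C : FIPowModule k m}

/-- A submodule of an `FI^m`-module, as an `FI^m`-module. -/
def toModule (W : Sub V) : FIPowModule k m where
  obj d := ModuleCat.of k (W.carrier d)
  map f := ModuleCat.ofHom ((V.map f).hom.restrict (fun _ hx => W.map_mem f hx))
  map_id d := by
    exact ModuleCat.hom_ext (LinearMap.ext fun x => Subtype.ext (map_id_apply V x.1))
  map_comp f g := by
    exact ModuleCat.hom_ext (LinearMap.ext fun x => Subtype.ext (map_comp_apply V f g x.1))

/-- The inclusion of a submodule. -/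
def incl (W : Sub V) : W.toModule ⟶ V where
  app d := ModuleCat.ofHom (W.carrier d).subtype
  naturality _ _ _ := rfl

/-- The morphism to a submodule induced by a morphism with values in it. -/
def lift (W : Sub V) (t : U ⟶ V) (h : ∀ d x, (t.app d).hom x ∈ W.carrier d) : U ⟶ W.toModule where
  app d := ModuleCat.ofHom ((t.app d).hom.codRestrict (W.carrier d) (h d))
  naturality d e f := by
    ext x
    exact Subtype.ext (app_map t f x)

theorem lift_incl (W : Sub V) (t : U ⟶ V) (h : ∀ d x, (t.app d).hom x ∈ W.carrier d) :
    W.lift t h ≫ W.incl = t := rfl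

/-- The quotient by a submodule. -/
def quot (W : Sub V) : FIPowModule k m where
  obj d := ModuleCat.of k (V.obj d ⧸ W.carrier d)
  map f := ModuleCat.ofHom (Submodule.mapQ _ _ (V.map f).hom (fun _ hx => W.map_mem f hx))
  map_id d := by
    ext1
    apply Submodule.linearMap_qext
    ext x
    exact congrArg (W.carrier d).mkQ (map_id_apply V x)
  map_comp {c d e} f g := by
    ext1
    apply Submodule.linearMap_qext
    ext x
    exact congrArg (W.carrier e).mkQ (map_comp_apply V f g x)

/-- The projection to the quotient by a submodule. -/
def mkQ (W : Sub V) : V ⟶ W.quot where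
  app d := ModuleCat.ofHom (W.carrier d).mkQ
  naturality _ _ _ := rfl

/-- The morphism `g` is surjective with kernel `W`. -/
structure IsQuotient (W : Sub V) (g : V ⟶ C) : Prop where
  surj : Surj g
  ker : ∀ d x, (g.app d).hom x = 0 ↔ x ∈ W.carrier d

theorem isQuotient_mkQ (W : Sub V) : W.IsQuotient W.mkQ :=
  ⟨fun d => (W.carrier d).mkQ_surjective, fun d _ => Submodule.Quotient.mk_eq_zero (W.carrier d)⟩

/-- The shift of a submodule. -/
def shift (a : FIPow m) (W : Sub V) : Sub (FIPowModule.shift a V) where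
  carrier d := W.carrier (FIPow.add d a)
  map_mem f _ hx := W.map_mem (FIPow.addMap f a) hx

theorem IsQuotient.shift {W : Sub V} {g : V ⟶ C} (h : W.IsQuotient g) (a : FIPow m) :
    (W.shift a).IsQuotient (C := FIPowModule.shift a C) (Functor.whiskerLeft (FIPow.addFunctor a) g) :=
  ⟨fun d => h.surj (FIPow.add d a), fun d => h.ker (FIPow.add d a)⟩

/-- If the quotient by a submodule is projective, the submodule is a retract. -/
theorem IsQuotient.exists_retraction {W : Sub V} {g : V ⟶ C} (h : W.IsQuotient g) [Projective C] :
    ∃ (s : C ⟶ V) (r : V ⟶ W.toModule), s ≫ g = 𝟙 C ∧ r ≫ W.incl = 𝟙 V - g ≫ s ∧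
      W.incl ≫ r = 𝟙 _ := by
  obtain ⟨s, hs⟩ := exists_section h.surj
  refine ⟨s, W.lift (𝟙 V - g ≫ s) fun d x => ?_, hs, lift_incl _ _ _, ?_⟩
  · rw [← h.ker]
    have : (𝟙 V - g ≫ s) ≫ g = 0 := by simp [hs]
    exact app_congr this d x
  · refine hom_ext fun d x => Subtype.ext ?_
    have hx : (g.app d).hom x.1 = 0 := (h.ker d _).2 x.2
    change x.1 - (s.app d).hom ((g.app d).hom x.1) = x.1
    rw [hx, map_zero, sub_zero]

theorem IsQuotient.projective_sub {W : Sub V} {g : V ⟶ C} (h : W.IsQuotient g) [Projective C]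
    [Projective V] : Projective W.toModule := by
  obtain ⟨s, r, -, -, hr⟩ := h.exists_retraction
  exact projective_of_retract W.incl r hr

theorem IsQuotient.projective_mid {W : Sub V} {g : V ⟶ C} (h : W.IsQuotient g) [Projective C]
    [Projective W.toModule] : Projective V := by
  obtain ⟨s, r, -, hr, -⟩ := h.exists_retraction
  refine projective_of_retract (V := W.toModule ⊞ C) (biprod.lift r g) (biprod.desc W.incl s) ?_
  rw [biprod.lift_desc, hr]
  simp

end Sub

/-! ### Generators, and the part of a shift generated in lower degrees -/

section Generators

variable {U V C : FIPowModule k m}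

/-- The submodule generated by a family of elements. -/
def spanSub {ι : Type*} (c : ι → FIPow m) (v : ∀ i, V.obj (c i)) : Sub V where
  carrier d := Submodule.span k (Set.range fun p : Σ i, c i ⟶ d => (V.map p.2).hom (v p.1))
  map_mem {d e} f x hx := by
    induction hx using Submodule.span_induction with
    | mem x hx =>
      obtain ⟨⟨i, h⟩, rfl⟩ := hx
      exact Submodule.subset_span ⟨⟨i, h ≫ f⟩, map_comp_apply V h f _⟩
    | zero => rw [map_zero]; exact zero_mem _
    | add x y _ _ hx hy => rw [map_add]; exact add_mem hx hy
    | smul r x _ hx => rw [map_smul]; exact Submodule.smul_mem _ r hx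

theorem map_mem_spanSub {ι : Type*} (c : ι → FIPow m) (v : ∀ i, V.obj (c i)) (i : ι) {d : FIPow m}
    (h : c i ⟶ d) : (V.map h).hom (v i) ∈ (spanSub c v).carrier d :=
  Submodule.subset_span ⟨⟨i, h⟩, rfl⟩

theorem mem_spanSub {ι : Type*} (c : ι → FIPow m) (v : ∀ i, V.obj (c i)) (i : ι) :
    v i ∈ (spanSub c v).carrier (c i) := by
  simpa [map_id_apply] using map_mem_spanSub c v i (𝟙 _)

theorem spanSub_le {ι : Type*} (c : ι → FIPow m) (v : ∀ i, V.obj (c i)) (W : Sub V)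
    (h : ∀ i, v i ∈ W.carrier (c i)) (d : FIPow m) : (spanSub c v).carrier d ≤ W.carrier d := by
  refine Submodule.span_le.2 ?_
  rintro _ ⟨⟨i, f⟩, rfl⟩
  exact W.map_mem f (h i)

/-- A family of elements generates an `FI^m`-module if it spans it together with its images. -/
def Generates {ι : Type*} (c : ι → FIPow m) (v : ∀ i, V.obj (c i)) : Prop :=
  ∀ d, (spanSub c v).carrier d = ⊤

/-- The preimage of a submodule. -/
def Sub.comap (φ : U ⟶ V) (W : Sub V) : Sub U where
  carrier d := (W.carrier d).comap (φ.app d).hom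
  map_mem f x hx := by
    rw [Submodule.mem_comap, app_map]
    exact W.map_mem f hx

theorem Generates.map {ι : Type*} {c : ι → FIPow m} {v : ∀ i, V.obj (c i)} (h : Generates c v)
    {g : V ⟶ C} (hg : Surj g) : Generates (V := C) c (fun i => (g.app (c i)).hom (v i)) := by
  intro d
  let w : ∀ i, C.obj (c i) := fun i => (g.app (c i)).hom (v i)
  have key : (spanSub c v).carrier d ≤ ((spanSub c w).comap g).carrier d :=
    spanSub_le c v ((spanSub c w).comap g) (mem_spanSub c w) d
  refine eq_top_iff.2 fun y _ => ?_
  obtain ⟨x, rfl⟩ := hg d y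
  exact key (h d ▸ Submodule.mem_top)

/-- The `FI^m`-module is generated by finitely many elements of total degree less than `n`. -/
def GenBelow (n : ℕ) (V : FIPowModule k m) : Prop :=
  ∃ (ι : Type) (_ : Finite ι) (c : ι → FIPow m) (v : ∀ i, V.obj (c i)),
    Generates c v ∧ ∀ i, (c i).deg < n

theorem GenBelow.of_surj {n : ℕ} (h : GenBelow n V) {g : V ⟶ C} (hg : Surj g) : GenBelow n C := by
  obtain ⟨ι, hι, c, v, hv, hc⟩ := h
  exact ⟨ι, hι, c, _, hv.map hg, hc⟩

theorem IsFinitelyGenerated.exists_generates (h : IsFinitelyGenerated V) :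
    ∃ (n : ℕ) (c : Fin n → FIPow m) (v : ∀ i, V.obj (c i)), Generates c v := by
  obtain ⟨n, c, v, hv⟩ := h
  exact ⟨n, c, v, hv _ (mem_spanSub c v)⟩

theorem IsFinitelyGenerated.exists_genBelow (h : IsFinitelyGenerated V) : ∃ n, GenBelow n V := by
  obtain ⟨n, c, v, hv⟩ := h.exists_generates
  refine ⟨∑ i, (c i).deg + 1, Fin n, inferInstance, c, v, hv, fun i => Nat.lt_succ_of_le ?_⟩
  exact Finset.single_le_sum (f := fun i => (c i).deg) (fun _ _ => Nat.zero_le _)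
    (Finset.mem_univ i)

/-- The part of the shift of a module generated by `v` that does not come from the inclusions
`d → d + a`. -/
def newPart {ι : Type*} (c : ι → FIPow m) (v : ∀ i, V.obj (c i)) (a : FIPow m) :
    Sub (shift a V) where
  carrier d := Submodule.span k {x | ∃ (i : ι) (h : c i ⟶ FIPow.add d a),
    (∀ h', h' ≫ FIPow.inl d a ≠ h) ∧ (V.map h).hom (v i) = x}
  map_mem {d e} f x hx := by
    induction hx using Submodule.span_induction with
    | mem x hx =>
      obtain ⟨i, h, hh, rfl⟩ := hx
      refine Submodule.subset_span ⟨i, h ≫ FIPow.addMap f a, fun h' hh' => ?_,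
        map_comp_apply V h _ _⟩
      -- A morphism that does not factor through `d → d + a` sends some point into `a`. Since `f +
      -- a` fixes `a` pointwise, the composite does so too.
      obtain ⟨j, x, y, hy⟩ : ∃ j x y, FIPow.fn h j x = Sum.inr y := by
        by_contra! hcon
        have : ∀ j x, ∃ y, FIPow.fn h j x = Sum.inl y := by
          intro j x
          rcases hx : FIPow.fn h j x with y | y
          · exact ⟨y, rfl⟩
          · exact absurd hx (hcon j x y)
        choose H hH using this
        refine hh (FIPow.homMk H fun j x x' hxx => FIPow.fn_injective h j ?_)
          (FIPow.hom_ext fun j x => (hH j x).symm)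
        rw [hH, hH, hxx]
      have := congrArg (fun q : c i ⟶ FIPow.add e a => FIPow.fn q j x) hh'
      simp only [FIPow.fn_comp, hy, FIPow.fn_inl, FIPow.fn_addMap_inr] at this
      cases this
    | zero => rw [map_zero]; exact zero_mem _
    | add x y _ _ hx hy => rw [map_add]; exact add_mem hx hy
    | smul r x _ hx => rw [map_smul]; exact Submodule.smul_mem _ r hx

/-- The natural morphism from an `FI^m`-module to its shift. -/
def toShift (a : FIPow m) (V : FIPowModule k m) : V ⟶ shift a V where
  app d := V.map (FIPow.inl d a)
  naturality d e f := by
    change V.map f ≫ V.map (FIPow.inl e a) = V.map (FIPow.inl d a) ≫ V.map (FIPow.addMap f a)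
    rw [← V.map_comp, ← V.map_comp, FIPow.inl_naturality]

/-- Each morphism from a generator to `d + a` either factors through `d` or contributes to
`newPart`. So V surjects onto `S_{+a}V / newPart`, and `newPart` surjects onto the cokernel of `V →
S_{+a}V`; both surjections are needed. -/
theorem Generates.exists_add_of_shift {ι : Type*} {c : ι → FIPow m} {v : ∀ i, V.obj (c i)}
    (h : Generates c v) (a d : FIPow m) (x : V.obj (FIPow.add d a)) :
    ∃ y : V.obj (FIPow.add d a), y ∈ (newPart c v a).carrier d ∧
      ∃ z : V.obj d, x = y + (V.map (FIPow.inl d a)).hom z := by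
  have hx : x ∈ (spanSub c v).carrier (FIPow.add d a) := h (FIPow.add d a) ▸ Submodule.mem_top
  induction hx using Submodule.span_induction with
  | mem x hx =>
    obtain ⟨⟨i, f⟩, rfl⟩ := hx
    by_cases hf : ∃ h', h' ≫ FIPow.inl d a = f
    · obtain ⟨h', rfl⟩ := hf
      exact ⟨0, ((newPart c v a).carrier d).zero_mem, (V.map h').hom (v i),
        (map_comp_apply V h' _ _).trans (zero_add _).symm⟩
    · exact ⟨_, Submodule.subset_span ⟨i, f, not_exists.1 hf, rfl⟩, 0, by rw [map_zero, add_zero]⟩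
  | zero => exact ⟨0, ((newPart c v a).carrier d).zero_mem, 0, by rw [map_zero, add_zero]⟩
  | add x x' _ _ hx hx' =>
    obtain ⟨y, hy, z, rfl⟩ := hx
    obtain ⟨y', hy', z', rfl⟩ := hx'
    refine ⟨y + y', ((newPart c v a).carrier d).add_mem hy hy', z + z', ?_⟩
    rw [map_add, add_add_add_comm]
  | smul r x _ hx =>
    obtain ⟨y, hy, z, rfl⟩ := hx
    refine ⟨r • y, ((newPart c v a).carrier d).smul_mem r hy, r • z, ?_⟩
    rw [map_smul, smul_add]

theorem generates_toModule {ι : Type*} {c : ι → FIPow m} (W : Sub V)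
    (w : ∀ i, W.toModule.obj (c i))
    (h : ∀ d, W.carrier d ≤ (spanSub c fun i => (W.incl.app (c i)).hom (w i)).carrier d) :
    Generates (V := W.toModule) c w := by
  intro d
  refine eq_top_iff.2 fun x _ => ?_
  have hx := h d x.2
  have : (spanSub c fun i => (W.incl.app (c i)).hom (w i)).carrier d
      = ((spanSub (V := W.toModule) c w).carrier d).map (W.incl.app d).hom := by
    simp only [spanSub]
    rw [Submodule.map_span, ← Set.range_comp]
    rfl
  rw [this] at hx
  obtain ⟨y, hy, hyx⟩ := hx
  exact (Subtype.ext hyx : y = x) ▸ hy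

/-- By the canonical factorisation, the images of the generators under canonical maps `c i → s + a`
suffice, and not factoring through `s` forces `s` to be a proper subset. This drop in degree drives
all the inductions. -/
theorem genBelow_newPart {ι : Type} [Finite ι] {c : ι → FIPow m} (v : ∀ i, V.obj (c i)) {n : ℕ}
    (hn : ∀ i, (c i).deg < n + 1) (a : FIPow m) : GenBelow n (newPart c v a).toModule := by
  let κ : Type := Σ i, Σ s : ∀ j, Set ((c i) j).carrier,
    {h : c i ⟶ FIPow.add (FIPow.ofSets s) a // (∀ h', h' ≫ FIPow.inl _ a ≠ h) ∧
      (FIPow.ofSets s).deg < (c i).deg}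
  have hκ : Finite κ := inferInstance
  refine ⟨κ, hκ, fun p => FIPow.ofSets p.2.1,
    fun p => ⟨(V.map p.2.2.1).hom (v p.1), Submodule.subset_span ⟨p.1, p.2.2.1, p.2.2.2.1, rfl⟩⟩,
    generates_toModule _ _ fun d => ?_,
    fun p => (p.2.2.2.2).trans_le (Nat.lt_succ_iff.1 (hn p.1))⟩
  refine Submodule.span_le.2 ?_
  rintro _ ⟨i, h, hh, rfl⟩
  obtain ⟨s, h₀, g, hs, rfl⟩ := FIPow.exists_canonical h
  have hh₀ : ∀ h', h' ≫ FIPow.inl _ a ≠ h₀ := by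
    rintro h' rfl
    exact hh (h' ≫ g) rfl
  have hlt : (FIPow.ofSets s).deg < (c i).deg := by
    refine FIPow.deg_ofSets_lt s ?_
    by_contra! hcon
    exact hh₀ (FIPow.homMk (fun j x => ⟨x, hcon j x⟩) fun j x x' hxx => congrArg Subtype.val hxx)
      (FIPow.hom_ext fun j x => ((hs j x).1 (hcon j x)).symm)
  exact Submodule.subset_span ⟨⟨⟨i, s, h₀, hh₀, hlt⟩, g⟩,
    (map_comp_apply V h₀ (FIPow.addMap g a) (v i)).symm⟩

end Generators

end FIPowModule

namespace FIPowModule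

variable {k : Type u} [Field k] {m : ℕ}

/-! ### Free modules and restriction along injections -/

section Free

variable {V : FIPowModule k m}

/-- A basis element of a free module. -/
def basisElt (k : Type u) [Field k] {c d : FIPow m} (h : c ⟶ d) : (free k c).obj d :=
  Finsupp.single h (1 : k)

theorem free_map_basisElt {c d e : FIPow m} (h : c ⟶ d) (f : d ⟶ e) :
    ((free k c).map f).hom (basisElt k h) = basisElt k (h ≫ f) :=
  Finsupp.mapDomain_single

theorem free_linearMap_ext {c d : FIPow m} {M : Type*} [AddCommGroup M] [Module k M]
    {f g : (free k c).obj d →ₗ[k] M} (h : ∀ φ, f (basisElt k φ) = g (basisElt k φ)) : f = g :=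
  Finsupp.lhom_ext' fun φ => LinearMap.ext_ring (h φ)

/-- The linear map out of a degree of a free module given by the images of the basis elements. -/
def basisLift {c d : FIPow m} {M : Type*} [AddCommGroup M] [Module k M] (v : (c ⟶ d) → M) :
    (free k c).obj d →ₗ[k] M :=
  Finsupp.linearCombination k v

theorem basisLift_basisElt {c d : FIPow m} {M : Type*} [AddCommGroup M] [Module k M]
    (v : (c ⟶ d) → M) (h : c ⟶ d) : basisLift v (basisElt k h) = v h :=
  (Finsupp.linearCombination_single k 1 h).trans (one_smul k _)

theorem free_hom_ext {c : FIPow m} {f g : free k c ⟶ V}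
    (h : ∀ d φ, (f.app d).hom (basisElt k φ) = (g.app d).hom (basisElt k φ)) : f = g := by
  ext1
  ext1 d
  exact ModuleCat.hom_ext (free_linearMap_ext (h d))

theorem free_map_injective {c d e : FIPow m} (f : d ⟶ e) :
    Function.Injective ((free k c).map f).hom :=
  Finsupp.mapDomain_injective (FIPow.comp_right_injective f)

/-- The morphism out of a free module determined by an element. -/
def freeLift {c : FIPow m} (v : V.obj c) : free k c ⟶ V where
  app d := ModuleCat.ofHom (basisLift fun h : c ⟶ d => (V.map h).hom v)
  naturality d e f := by
    refine ModuleCat.hom_ext (free_linearMap_ext fun φ => ?_)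
    change basisLift _ (((free k c).map f).hom (basisElt k φ)) =
      (V.map f).hom (basisLift _ (basisElt k φ))
    rw [free_map_basisElt, basisLift_basisElt, basisLift_basisElt, map_comp_apply]

theorem freeLift_basisElt {c d : FIPow m} (v : V.obj c) (h : c ⟶ d) :
    ((freeLift v).app d).hom (basisElt k h) = (V.map h).hom v :=
  basisLift_basisElt _ h

theorem freeLift_id {c : FIPow m} (v : V.obj c) :
    ((freeLift v).app c).hom (basisElt k (𝟙 c)) = v := by
  rw [freeLift_basisElt, map_id_apply]

theorem eq_freeLift {c : FIPow m} (f : free k c ⟶ V) :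
    f = freeLift ((f.app c).hom (basisElt k (𝟙 c))) :=
  free_hom_ext fun d φ => by
    rw [freeLift_basisElt, ← app_map, free_map_basisElt, Category.id_comp]

instance projective_free (c : FIPow m) : Projective (free k c) where
  factors {E F} f e he := by
    obtain ⟨v, hv⟩ := (epi_iff_surj e).1 he c ((f.app c).hom (basisElt k (𝟙 c)))
    refine ⟨freeLift v, ?_⟩
    rw [eq_freeLift f, eq_freeLift (freeLift v ≫ e), comp_app_apply, freeLift_id, hv]

/-- The linear map `M(c)_d → M(c)_s` that picks the injections with values in the image of
`φ : s → d`. -/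
def pull {c s d : FIPow m} (φ : s ⟶ d) : (free k c).obj d →ₗ[k] (free k c).obj s :=
  Finsupp.lcomapDomain (fun h : c ⟶ s => h ≫ φ) (FIPow.comp_right_injective φ)

theorem pull_comp {c r s d : FIPow m} (φ : r ⟶ s) (ψ : s ⟶ d) (x : (free k c).obj d) :
    pull (φ ≫ ψ) x = pull φ (pull ψ x) :=
  Finsupp.ext fun _ => rfl

theorem pull_map {c s d : FIPow m} (φ : s ⟶ d) (x : (free k c).obj s) :
    pull φ (((free k c).map φ).hom x) = x :=
  Finsupp.ext fun _ => Finsupp.mapDomain_apply (FIPow.comp_right_injective φ) x _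

theorem pull_basisElt_comp {c s d : FIPow m} (φ : s ⟶ d) (h : c ⟶ s) :
    pull φ (basisElt k (h ≫ φ)) = basisElt k h := by
  rw [← free_map_basisElt, pull_map]

theorem pull_basisElt_of_forall_ne {c s d : FIPow m} (φ : s ⟶ d) (g : c ⟶ d)
    (hg : ∀ h, h ≫ φ ≠ g) : pull φ (basisElt k g) = 0 :=
  Finsupp.ext fun h => Finsupp.single_eq_of_ne (hg h)

/-- Morphisms between free modules that do not lower the degree commute with `pull`. -/
theorem app_pull {b c s d : FIPow m} (hbc : b.deg ≤ c.deg) (θ : free k b ⟶ free k c) (φ : s ⟶ d)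
    (z : (free k b).obj d) : (θ.app s).hom (pull φ z) = pull φ ((θ.app d).hom z) := by
  rw [eq_freeLift θ]
  generalize (θ.app b).hom (basisElt k (𝟙 b)) = t
  have key : ∀ g : b ⟶ d, ((freeLift t).app s).hom (pull φ (basisElt k g)) =
      pull φ (((freeLift t).app d).hom (basisElt k g)) := by
    intro g
    rw [freeLift_basisElt]
    by_cases hg : ∃ h, h ≫ φ = g
    · obtain ⟨h, rfl⟩ := hg
      rw [pull_basisElt_comp, freeLift_basisElt, map_comp_apply, pull_map]
    · rw [pull_basisElt_of_forall_ne φ g (not_exists.1 hg), map_zero]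
      -- By `hbc` every `q : c → b` is invertible, so if `q ≫ g` factored through `φ`, then `g`
      -- would as well.
      have : pull φ ∘ₗ ((free k c).map g).hom = 0 := by
        refine free_linearMap_ext fun q => ?_
        obtain ⟨r, -, hr⟩ := FIPow.exists_inv_of_deg_le q hbc
        rw [LinearMap.comp_apply, free_map_basisElt, pull_basisElt_of_forall_ne,
          LinearMap.zero_apply]
        intro σ hσ
        exact hg ⟨r ≫ σ, by rw [Category.assoc, hσ, ← Category.assoc, hr, Category.id_comp]⟩
      exact (LinearMap.congr_fun this t).symm
  exact LinearMap.congr_fun (free_linearMap_ext (f := ((freeLift t).app s).hom ∘ₗ pull φ)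
    (g := pull φ ∘ₗ ((freeLift t).app d).hom) key) z

end Free

/-! ### Averaging over injections -/

section Maschke

/-- On a basis element `h`, the only `φ` that contribute are `σ ≫ h` with `σ` an automorphism of
`c`, and each contributes `h`. -/
theorem sum_map_pull {c d : FIPow m} (x : (free k c).obj d) :
    ∑ φ : c ⟶ d, ((free k c).map φ).hom (pull φ x) = (Fintype.card (c ⟶ c) : k) • x := by
  have key : ∑ φ : c ⟶ d, ((free k c).map φ).hom ∘ₗ pull φ =
      (Fintype.card (c ⟶ c) : k) • (LinearMap.id : (free k c).obj d →ₗ[k] _) := by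
    refine free_linearMap_ext fun h => ?_
    rw [LinearMap.sum_apply, LinearMap.smul_apply, LinearMap.id_apply, Nat.cast_smul_eq_nsmul,
      ← Finset.card_univ, ← Finset.sum_const]
    refine (Fintype.sum_of_injective (fun σ : c ⟶ c => σ ≫ h) ?_ _ _ ?_ ?_).symm
    · exact FIPow.comp_right_injective h
    · intro φ hφ
      rw [LinearMap.comp_apply, pull_basisElt_of_forall_ne, map_zero]
      rintro σ rfl
      obtain ⟨τ, -, hτ⟩ := FIPow.exists_inv_of_deg_le σ le_rfl
      exact hφ ⟨τ, by simp only [← Category.assoc, hτ, Category.id_comp]⟩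
    · intro σ
      obtain ⟨τ, -, hτ⟩ := FIPow.exists_inv_of_deg_le σ le_rfl
      have hσ : τ ≫ σ ≫ h = h := by rw [← Category.assoc, hτ, Category.id_comp]
      have := pull_basisElt_comp (k := k) (σ ≫ h) τ
      rw [hσ] at this
      rw [LinearMap.comp_apply, this, free_map_basisElt, hσ]
  have := LinearMap.congr_fun key x
  rwa [LinearMap.sum_apply] at this

theorem pull_map_of_forall_ne {c d e : FIPow m} (f : d ⟶ e) (φ : c ⟶ e) (h : ∀ ψ, ψ ≫ f ≠ φ)
    (x : (free k c).obj d) : pull φ (((free k c).map f).hom x) = 0 := by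
  have key : pull φ ∘ₗ ((free k c).map f).hom = 0 := by
    refine free_linearMap_ext fun g => ?_
    rw [LinearMap.comp_apply, free_map_basisElt, pull_basisElt_of_forall_ne, LinearMap.zero_apply]
    intro σ hσ
    obtain ⟨τ, -, hτ⟩ := FIPow.exists_inv_of_deg_le σ le_rfl
    exact h (τ ≫ g) (by rw [Category.assoc, ← hσ, ← Category.assoc, hτ, Category.id_comp])
  exact LinearMap.congr_fun key x

variable [CharZero k]

/-- A quotient of `M(c)` is projective if its kernel is determined by its part in degree `c`. -/
theorem projective_of_pull_mem {c : FIPow m} {Q : FIPowModule k m} {π : free k c ⟶ Q}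
    (hπ : Surj π)
    (h : ∀ d (φ : c ⟶ d) x, (π.app d).hom x = 0 → (π.app c).hom (pull φ x) = 0) :
    Projective Q := by
  let E := (free k c).obj c
  let K : Submodule k E := LinearMap.ker (π.app c).hom
  obtain ⟨p, hp⟩ := K.subtype.exists_leftInverse_of_injective K.ker_subtype
  have hp' : ∀ x, (π.app c).hom x = 0 → (p x : E) = x := fun x hx =>
    congrArg Subtype.val (LinearMap.congr_fun hp ⟨x, hx⟩)
  -- The retraction `p` onto the degree-`c` kernel is only linear. Averaging over all `φ : c → d`,
  -- hence also over automorphisms of `c`, makes it natural in `d`.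
  let T : ∀ d, (free k c).obj d →ₗ[k] (free k c).obj d := fun d =>
    (Fintype.card (c ⟶ c) : k)⁻¹ •
      ∑ φ : c ⟶ d, ((free k c).map φ).hom ∘ₗ K.subtype ∘ₗ p ∘ₗ pull φ
  have hT : ∀ d x, T d x = (Fintype.card (c ⟶ c) : k)⁻¹ •
      ∑ φ : c ⟶ d, ((free k c).map φ).hom (p (pull φ x) : E) := by
    intro d x
    simp only [T, LinearMap.smul_apply, LinearMap.sum_apply]
    rfl
  let τ : free k c ⟶ free k c :=
    { app := fun d => ModuleCat.ofHom (T d)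
      naturality := fun d e f => by
        refine ModuleCat.hom_ext (LinearMap.ext fun x => ?_)
        change T e (((free k c).map f).hom x) = ((free k c).map f).hom (T d x)
        rw [hT, hT, map_smul, map_sum]
        congr 1
        refine (Fintype.sum_of_injective (fun φ : c ⟶ d => φ ≫ f)
          (FIPow.comp_right_injective f) _ _ ?_ ?_).symm
        · intro φ hφ
          rw [pull_map_of_forall_ne f φ (fun ψ hψ => hφ ⟨ψ, hψ⟩), map_zero]
          exact map_zero _
        · intro φ
          rw [pull_comp, pull_map, map_comp_apply] }
  have hcard : (Fintype.card (c ⟶ c) : k) ≠ 0 := by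
    have : Nonempty (c ⟶ c) := ⟨𝟙 c⟩
    exact Nat.cast_ne_zero.2 Fintype.card_ne_zero
  have hτ : ∀ d x, (π.app d).hom x = 0 → T d x = x := by
    intro d x hx
    rw [hT]
    have : ∀ φ : c ⟶ d, (p (pull φ x) : E) = pull φ x := fun φ => hp' _ (h d φ x hx)
    simp only [this]
    rw [sum_map_pull, smul_smul, inv_mul_cancel₀ hcard, one_smul]
  have hτπ : τ ≫ π = 0 := by
    refine hom_ext fun d x => ?_
    change (π.app d).hom (T d x) = 0
    rw [hT, map_smul, map_sum, Finset.sum_eq_zero, smul_zero]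
    intro φ _
    rw [app_map]
    have : (π.app c).hom (p (pull φ x) : E) = 0 := (p (pull φ x)).2
    rw [this, map_zero]
  -- Since `τ` takes values in the kernel of `π` and is the identity there, `1 - τ` descends to a
  -- section of `π`.
  obtain ⟨s, hs⟩ := exists_desc hπ (𝟙 _ - τ) fun d x hx => by
    change x - T d x = 0
    rw [hτ d x hx, sub_self]
  have := (epi_iff_surj π).2 hπ
  refine projective_of_retract s π ?_
  rw [← cancel_epi π, ← Category.assoc, hs]
  simp [hτπ]

end Maschke

/-! ### Shifts of free modules -/

section ShiftFree

open FIPow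

/-- By the canonical factorisation, `S_{+a}M(c)` is free on the canonical morphisms `c → s + a`,
placed in degree `s`. A lift may therefore be chosen at these and transported along `g`. -/
instance projective_shift_free (a c : FIPow m) : Projective (shift a (free k c)) where
  factors {E F} f e he := by
    have he := (epi_iff_surj e).1 he
    choose s h₀ g hs hg using fun (d : FIPow m) (h : c ⟶ add d a) => exists_canonical h
    let t : ∀ s : ∀ i, Set (c i).carrier, (c ⟶ add (ofSets s) a) → F.obj (ofSets s) :=
      fun s h => (f.app (ofSets s)).hom (basisElt k h)
    choose ε hε using fun (s : ∀ i, Set (c i).carrier) (h : c ⟶ add (ofSets s) a) =>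
      he (ofSets s) (t s h)
    let L : ∀ d, (free k c).obj (add d a) →ₗ[k] E.obj d := fun d =>
      basisLift fun h : c ⟶ add d a => (E.map (g d h)).hom (ε (s d h) (h₀ d h))
    have hL : ∀ (s' : ∀ i, Set (c i).carrier) (h' : c ⟶ add (ofSets s') a) (d : FIPow m)
        (g' : ofSets s' ⟶ d), IsCanonical s' h' →
        L d (basisElt k (h' ≫ addMap g' a)) = (E.map g').hom (ε s' h') := by
      intro s' h' d g' hs'
      exact (basisLift_basisElt _ _).trans (canonical_unique (hs d (h' ≫ addMap g' a)) hs'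
        (hg d (h' ≫ addMap g' a)) fun s h g => (E.map g).hom (ε s h))
    refine ⟨{ app := fun d => ModuleCat.ofHom (L d), naturality := fun d d' q => ?_ }, ?_⟩
    · refine ModuleCat.hom_ext (free_linearMap_ext (c := c) (d := add d a) fun φ => ?_)
      obtain ⟨s, h, g, hs, rfl⟩ := exists_canonical φ
      change L d' (((free k c).map (addMap q a)).hom (basisElt k (h ≫ addMap g a))) =
        (E.map q).hom (L d (basisElt k (h ≫ addMap g a)))
      rw [free_map_basisElt, Category.assoc, ← Functor.map_comp, hL _ _ _ _ hs, hL _ _ _ _ hs,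
        map_comp_apply]
    · ext1
      ext1 d
      refine ModuleCat.hom_ext (free_linearMap_ext (c := c) (d := add d a) fun φ => ?_)
      obtain ⟨s, h, g, hs, rfl⟩ := exists_canonical φ
      change (e.app d).hom (L d (basisElt k (h ≫ addMap g a))) = _
      rw [hL _ _ _ _ hs, app_map, hε]
      exact (app_map f g (basisElt k h)).symm.trans
        (congrArg (f.app d).hom (free_map_basisElt h (addMap g a)))

end ShiftFree

end FIPowModule

/-! ### Iterated shifts, and projectivity under shifting -/

namespace FIPow

variable {m : ℕ}

/-- An isomorphism of `FI^m` given by a family of bijections. -/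
def isoMk {c d : FIPow m} (e : ∀ i, (c i).carrier ≃ (d i).carrier) : c ≅ d where
  hom := homMk (fun i => e i) fun i => (e i).injective
  inv := homMk (fun i => (e i).symm) fun i => (e i).symm.injective
  hom_inv_id := hom_ext fun i x => (e i).symm_apply_apply x
  inv_hom_id := hom_ext fun i x => (e i).apply_symm_apply x

/-- Adding `b` and then `a` is adding `b + a`. -/
def addAssocIso (a b : FIPow m) : addFunctor b ⋙ addFunctor a ≅ addFunctor (add b a) :=
  NatIso.ofComponents (fun d => isoMk fun i => Equiv.sumAssoc (d i).carrier (b i).carrier (a i).carrier)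
    fun f => hom_ext fun i x => by rcases x with (x | x) | x <;> rfl

/-- The symmetry `(d + b) + a ≅ (d + a) + b`. -/
def addSwapIso (a b : FIPow m) : addFunctor b ⋙ addFunctor a ≅ addFunctor a ⋙ addFunctor b :=
  NatIso.ofComponents
    (fun d => isoMk fun i => (Equiv.sumAssoc (d i).carrier (b i).carrier (a i).carrier).trans
      ((Equiv.sumCongr (Equiv.refl _) (Equiv.sumComm _ _)).trans (Equiv.sumAssoc _ _ _).symm))
    fun f => hom_ext fun i x => by rcases x with (x | x) | x <;> rfl

end FIPow

namespace FIPowModule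

variable {k : Type u} [Field k] {m : ℕ} {U V C : FIPowModule k m}

theorem projective_of_isomorphism (e : U ≅ V) [Projective U] : Projective V :=
  projective_of_retract e.inv e.hom e.inv_hom_id

theorem projective_shift_add (a b : FIPow m) [Projective (shift b (shift a V))] :
    Projective (shift (FIPow.add b a) V) :=
  projective_of_isomorphism (U := shift b (shift a V))
    (Functor.isoWhiskerRight (FIPow.addAssocIso a b) V)

/-- The shift of a morphism. -/
def shiftMap (a : FIPow m) (f : U ⟶ V) : shift a U ⟶ shift a V :=
  Functor.whiskerLeft (FIPow.addFunctor a) f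

theorem shiftMap_id (a : FIPow m) (V : FIPowModule k m) : shiftMap a (𝟙 V) = 𝟙 (shift a V) := rfl

theorem shiftMap_comp (a : FIPow m) (f : U ⟶ V) (g : V ⟶ C) :
    shiftMap a (f ≫ g) = shiftMap a f ≫ shiftMap a g := rfl

theorem projective_shift_shift (a b : FIPow m) [Projective (shift (FIPow.add b a) V)] :
    Projective (shift b (shift a V)) :=
  projective_of_isomorphism (U := shift (FIPow.add b a) V) (V := shift b (shift a V))
    (Functor.isoWhiskerRight (FIPow.addAssocIso a b) V).symm

theorem projective_shift_comm (a b : FIPow m) [Projective (shift b (shift a V))] :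
    Projective (shift a (shift b V)) :=
  projective_of_isomorphism (U := shift b (shift a V)) (V := shift a (shift b V))
    (Functor.isoWhiskerRight (FIPow.addSwapIso a b) V)

theorem projective_of_forall_eq_zero (h : ∀ d (x : V.obj d), x = 0) : Projective V where
  factors f e _ := ⟨0, hom_ext fun d x => by rw [h d x, map_zero, map_zero]⟩

instance projective_biproduct {ι : Type} [Finite ι] (F : ι → FIPowModule k m)
    [∀ i, Projective (F i)] : Projective (⨁ F) where
  factors f e _ := ⟨biproduct.desc fun i => Projective.factorThru (biproduct.ι F i ≫ f) e,
    biproduct.hom_ext' _ _ fun i => by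
      rw [biproduct.ι_desc_assoc, Projective.factorThru_comp]⟩

instance projective_shift_biproduct {ι : Type} [Finite ι] (c : ι → FIPow m) (a : FIPow m) :
    Projective (shift a (⨁ fun i => free k (c i))) :=
  projective_of_isomorphism (U := ⨁ fun i => shift a (free k (c i)))
    (V := shift a (⨁ fun i => free k (c i))) (((Functor.whiskeringLeft _ _ (ModuleCat.{u} k)).obj
    (FIPow.addFunctor a)).mapBiproduct fun i => free k (c i)).symm

/-- The morphism from a sum of free modules given by a family of elements. -/
def familyLift {ι : Type} [Finite ι] (c : ι → FIPow m) (v : ∀ i, V.obj (c i)) :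
    (⨁ fun i => free k (c i)) ⟶ V :=
  biproduct.desc fun i => freeLift (v i)

theorem Generates.surj_familyLift {ι : Type} [Finite ι] {c : ι → FIPow m} {v : ∀ i, V.obj (c i)}
    (h : Generates c v) : Surj (familyLift c v) := by
  intro d
  rw [← LinearMap.range_eq_top]
  refine eq_top_iff.2 ((h d).symm.le.trans (spanSub_le c v (range (familyLift c v)) (fun i => ?_) d))
  refine ⟨((biproduct.ι (fun i => free k (c i)) i).app (c i)).hom (basisElt k (𝟙 _)), ?_⟩
  rw [← comp_app_apply, familyLift, biproduct.ι_desc, freeLift_id]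

theorem Generates.exists_cover {ι : Type} [Finite ι] {c : ι → FIPow m} {v : ∀ i, V.obj (c i)}
    (h : Generates c v) : ∃ (X : FIPowModule k m) (p : X ⟶ V), Surj p ∧
      ∀ a, Projective (shift a X) :=
  ⟨_, _, h.surj_familyLift, fun a => projective_shift_biproduct c a⟩

/-- A projective V is a retract of any cover, and shifting preserves retracts. -/
theorem projective_shift_of_cover {X : FIPowModule k m} {p : X ⟶ V} (hp : Surj p) (a : FIPow m)
    [Projective (shift a X)] [Projective V] : Projective (shift a V) := by
  obtain ⟨s, hs⟩ := exists_section hp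
  refine projective_of_retract (shiftMap a s) (shiftMap a p) ?_
  rw [← shiftMap_comp, hs, shiftMap_id]

theorem Generates.projective_shift_shift {ι : Type} [Finite ι] {c : ι → FIPow m}
    {v : ∀ i, V.obj (c i)} (h : Generates c v) (a b : FIPow m) [Projective (shift a V)] :
    Projective (shift b (shift a V)) := by
  obtain ⟨X, p, hp, hX⟩ := h.exists_cover
  have := hX (FIPow.add b a)
  have : Projective (shift b (shift a X)) := FIPowModule.projective_shift_shift a b
  exact projective_shift_of_cover (p := shiftMap a p) (fun d => hp _) b

theorem Generates.of_surjective {ι κ : Type*} {c : ι → FIPow m} {v : ∀ i, V.obj (c i)}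
    (h : Generates c v) {e : κ → ι} (he : Function.Surjective e) :
    Generates (fun j => c (e j)) (fun j => v (e j)) := by
  intro d
  refine eq_top_iff.2 ((h d).symm.le.trans (spanSub_le c v _ (fun i => ?_) d))
  obtain ⟨j, rfl⟩ := he i
  exact mem_spanSub (fun j => c (e j)) (fun j => v (e j)) j

theorem Generates.eq_zero {ι : Type*} [IsEmpty ι] {c : ι → FIPow m} {v : ∀ i, V.obj (c i)}
    (h : Generates c v) (d : FIPow m) (x : V.obj d) : x = 0 := by
  have hx : x ∈ (spanSub c v).carrier d := h d ▸ Submodule.mem_top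
  have : IsEmpty (Σ i, c i ⟶ d) := ⟨fun p => isEmptyElim p.1⟩
  simp only [spanSub] at hx
  rwa [Set.range_eq_empty, Submodule.span_empty, Submodule.mem_bot] at hx

/-! ### Cyclic modules modulo the new part of a shift -/

section Cyclic

/-- The elements killed by `pull (inl d a)` are exactly the combinations of injections that do not
factor through `d`. -/
theorem mem_newPart_iff {c : FIPow m} (v : V.obj c) (a d : FIPow m) (y : V.obj (FIPow.add d a)) :
    y ∈ (newPart (fun _ : Unit => c) (fun _ => v) a).carrier d ↔
      ∃ z : (free k c).obj (FIPow.add d a), pull (FIPow.inl d a) z = 0 ∧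
        ((freeLift v).app _).hom z = y := by
  constructor
  · suffices (newPart (fun _ : Unit => c) (fun _ => v) a).carrier d ≤
        (LinearMap.ker (pull (k := k) (c := c) (FIPow.inl d a))).map
          ((freeLift v).app (FIPow.add d a)).hom from fun h => this h
    refine Submodule.span_le.2 ?_
    rintro _ ⟨_, h, hh, rfl⟩
    exact ⟨basisElt k h, pull_basisElt_of_forall_ne _ _ hh, freeLift_basisElt v h⟩
  · rintro ⟨z, hz, rfl⟩
    refine ((newPart (fun _ : Unit => c) (fun _ => v) a).carrier d).sum_mem fun h hh =>
      ((newPart (fun _ : Unit => c) (fun _ => v) a).carrier d).smul_mem _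
        (Submodule.subset_span ?_)
    refine ⟨(), h, fun h' hh' => Finsupp.mem_support_iff.1 hh ?_, rfl⟩
    rw [← hh']
    exact DFunLike.congr_fun (F := (c ⟶ d) →₀ k) hz h'

/-- After a large enough shift, a cyclic module becomes projective modulo the part generated in
lower degrees. -/
theorem exists_projective_quot_newPart [CharZero k] {c : FIPow m} (v : V.obj c)
    (hv : Generates (fun _ : Unit => c) (fun _ => v)) :
    ∃ (a : FIPow m) (π : free k c ⟶ (newPart (fun _ : Unit => c) (fun _ => v) a).quot),
      Surj π ∧ Projective (newPart (fun _ : Unit => c) (fun _ => v) a).quot := by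
  -- `U d φ` is the restriction along `φ` of the relations of V in degree `d`, inside the
  -- finite-dimensional space `k[End c]`. It can only grow when `φ` is prolonged.
  let U : ∀ d, (c ⟶ d) → Submodule k ((free k c).obj c) := fun d φ =>
    (LinearMap.ker ((freeLift v).app d).hom).map (pull φ)
  have hU : ∀ d e (φ : c ⟶ d) (ψ : d ⟶ e), U d φ ≤ U e (φ ≫ ψ) := by
    rintro d e φ ψ _ ⟨x, hx, rfl⟩
    refine ⟨((free k c).map ψ).hom x, ?_, ?_⟩
    · have hx : ((freeLift v).app d).hom x = 0 := hx
      change ((freeLift v).app e).hom _ = 0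
      rw [app_map, hx, map_zero]
    · rw [pull_comp, pull_map]
  have : IsNoetherian k ((free k c).obj c) := inferInstanceAs (IsNoetherian k ((c ⟶ c) →₀ k))
  obtain ⟨_, ⟨⟨a, φ₀⟩, rfl⟩, hmax⟩ := set_has_maximal_iff_noetherian.2 this
    (Set.range fun p : Σ d, c ⟶ d => U p.1 p.2) ⟨_, ⟨⟨c, 𝟙 c⟩, rfl⟩⟩
  -- Any `φ` amalgamates with `φ₀`, so the maximal subspace is the greatest. Amalgamating `φ₀` with
  -- the identity of `c` shows that it is attained at the inclusion `c → c + a`.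
  have hmax' : ∀ d (φ : c ⟶ d), U d φ ≤ U _ (FIPow.inl c a) := by
    intro d φ
    obtain ⟨ψ, hψ⟩ := FIPow.exists_amalgam φ φ₀
    obtain ⟨χ, hχ⟩ := FIPow.exists_amalgam (𝟙 c) φ₀
    have h₁ : U a φ₀ = U _ (φ₀ ≫ ψ) :=
      eq_of_le_of_not_lt (hU _ _ φ₀ ψ) (hmax _ ⟨⟨_, φ₀ ≫ ψ⟩, rfl⟩)
    calc U d φ ≤ U _ (φ ≫ FIPow.inl d a) := hU _ _ _ _
      _ = U a φ₀ := by rw [h₁, hψ]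
      _ ≤ U _ (φ₀ ≫ χ) := hU _ _ _ _
      _ = U _ (FIPow.inl c a) := by rw [hχ, Category.id_comp]
  let S := newPart (fun _ : Unit => c) (fun _ => v) a
  let π : free k c ⟶ S.quot := freeLift v ≫ toShift a V ≫ S.mkQ
  have hπ₀ : ∀ d x, (π.app d).hom x = 0 ↔
      ((freeLift v).app _).hom (((free k c).map (FIPow.inl d a)).hom x) ∈ S.carrier d := by
    intro d x
    rw [app_map]
    exact S.isQuotient_mkQ.ker d _
  have hfree : Surj (freeLift v) := by
    intro d
    rw [← LinearMap.range_eq_top]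
    refine eq_top_iff.2 ((hv d).symm.le.trans
      (spanSub_le _ _ (range (freeLift v)) (fun _ => ⟨basisElt k (𝟙 c), freeLift_id v⟩) d))
  have hπ : Surj π := by
    intro d q
    obtain ⟨x, rfl⟩ := S.isQuotient_mkQ.surj d q
    obtain ⟨y, hy, z, rfl⟩ := hv.exists_add_of_shift a d x
    obtain ⟨w, rfl⟩ := hfree d z
    refine ⟨w, ?_⟩
    have hy' := (S.isQuotient_mkQ.ker d y).2 hy
    exact ((map_add (S.mkQ.app d).hom y _).trans
      ((congrArg (· + _) hy').trans (zero_add _))).symm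
  refine ⟨a, π, hπ, projective_of_pull_mem hπ fun d φ x hx => ?_⟩
  -- Modulo some `z` that restricts to zero on `d`, the image of `x` is a relation, so `pull φ x` is
  -- the restriction of a relation. By maximality it is already the restriction of a relation `y` in
  -- degree `c + a`, which puts it in the kernel of `π` in degree `c`.
  rw [hπ₀, mem_newPart_iff] at hx ⊢
  obtain ⟨z, hz, hzx⟩ := hx
  have hmem : pull φ x ∈ U _ (FIPow.inl c a) := by
    refine hmax' _ (φ ≫ FIPow.inl d a) ⟨((free k c).map (FIPow.inl d a)).hom x - z, ?_, ?_⟩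
    · change ((freeLift v).app _).hom _ = 0
      rw [map_sub, hzx, sub_self]
    · rw [pull_comp, map_sub, pull_map, hz, sub_zero]
  obtain ⟨y, hy, hyx⟩ := hmem
  have hy : ((freeLift v).app _).hom y = 0 := hy
  refine ⟨((free k c).map (FIPow.inl c a)).hom (pull φ x) - y, ?_, ?_⟩
  · rw [map_sub, pull_map, hyx, sub_self]
  · rw [map_sub, hy, sub_zero]

end Cyclic

/-! ### Some shift of a finitely generated module is projective -/

section ShiftProjective

variable [CharZero k]

/-- The module `S_{+b}S_{+a}V` is an extension of the shifted quotient, projective because it is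
covered by a free module, by the shifted `newPart`, projective by induction. -/
theorem exists_shift_projective_of_cyclic {n : ℕ}
    (ih : ∀ W : FIPowModule k m, GenBelow n W → ∃ a, Projective (shift a W)) {c : FIPow m}
    (hc : c.deg < n + 1) (v : V.obj c) (hv : Generates (fun _ : Unit => c) (fun _ => v)) :
    ∃ a, Projective (shift a V) := by
  obtain ⟨a, π, hπ, hQ⟩ := exists_projective_quot_newPart v hv
  obtain ⟨b, hb⟩ := ih _ (genBelow_newPart (fun _ : Unit => v) (fun _ => hc) a)
  have h := (newPart (fun _ : Unit => c) (fun _ => v) a).isQuotient_mkQ.shift b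
  have : Projective (shift b (newPart (fun _ : Unit => c) (fun _ => v) a).quot) :=
    projective_shift_of_cover hπ b
  have : Projective ((newPart (fun _ : Unit => c) (fun _ => v) a).shift b).toModule := hb
  have : Projective (shift b (shift a V)) := h.projective_mid
  exact ⟨_, projective_shift_add a b⟩

/-- Induction on the number of generators: modulo the submodule `W` generated by all but the last, V
is cyclic. The shifts found for `W` and for the quotient are combined, each preserving the
projectivity won by the other. -/
theorem Generates.exists_shift_projective {n : ℕ}
    (ih : ∀ W : FIPowModule k m, GenBelow n W → ∃ a, Projective (shift a W)) {g : ℕ}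
    {c : Fin g → FIPow m} {v : ∀ i, V.obj (c i)} (hv : Generates c v)
    (hc : ∀ i, (c i).deg < n + 1) : ∃ a, Projective (shift a V) := by
  induction g generalizing V with
  | zero => exact ⟨fun _ => ⟨Empty⟩, projective_of_forall_eq_zero fun d x => hv.eq_zero _ x⟩
  | succ g ihg =>
    let W : Sub V := spanSub (fun i : Fin g => c i.castSucc) (fun i => v i.castSucc)
    let w : ∀ i : Fin g, W.toModule.obj (c i.castSucc) := fun i =>
      ⟨v i.castSucc, mem_spanSub (fun i : Fin g => c i.castSucc) (fun i => v i.castSucc) i⟩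
    have hw : Generates (V := W.toModule) (fun i : Fin g => c i.castSucc) w :=
      generates_toModule W w fun d => le_rfl
    have hQ : W.IsQuotient W.mkQ := W.isQuotient_mkQ
    let q := (W.mkQ.app (c (Fin.last g))).hom (v (Fin.last g))
    have hq : Generates (V := W.quot) (fun _ : Unit => c (Fin.last g)) (fun _ => q) := by
      intro d
      refine eq_top_iff.2 ((hv.map hQ.surj d).symm.le.trans (spanSub_le _ _ _ (fun i => ?_) d))
      induction i using Fin.lastCases with
      | last => exact mem_spanSub (fun _ : Unit => c (Fin.last g)) (fun _ => q) ()
      | cast i =>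
        have : (W.mkQ.app (c i.castSucc)).hom (v i.castSucc) = 0 := (hQ.ker _ _).2 (w i).2
        rw [this]
        exact zero_mem _
    obtain ⟨a, ha⟩ := ihg hw fun i => hc _
    obtain ⟨b, hb⟩ := exists_shift_projective_of_cyclic ih (hc _) q hq
    have : Projective (shift b (shift a W.toModule)) := hw.projective_shift_shift a b
    have : Projective ((W.shift a).shift b).toModule := this
    have : Projective (shift a (shift b W.quot)) := hq.projective_shift_shift b a
    have : Projective (shift b (shift a W.quot)) := projective_shift_comm b a
    have : Projective (shift b (shift a V)) := ((hQ.shift a).shift b).projective_mid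
    exact ⟨_, projective_shift_add a b⟩

theorem exists_shift_projective_of_genBelow (n : ℕ) (V : FIPowModule k m) (hV : GenBelow n V) :
    ∃ a, Projective (shift a V) := by
  induction n generalizing V with
  | zero =>
    obtain ⟨ι, -, c, v, hv, hc⟩ := hV
    have : IsEmpty ι := ⟨fun i => Nat.not_lt_zero _ (hc i)⟩
    exact ⟨fun _ => ⟨Empty⟩, projective_of_forall_eq_zero fun d x => hv.eq_zero _ x⟩
  | succ n ih =>
    obtain ⟨ι, hι, c, v, hv, hc⟩ := hV
    obtain ⟨g, ⟨e⟩⟩ := Finite.exists_equiv_fin ι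
    exact (hv.of_surjective e.symm.surjective).exists_shift_projective ih fun j => hc _

theorem IsFinitelyGenerated.exists_shift_projective (hV : IsFinitelyGenerated V) :
    ∃ a, Projective (shift a V) := by
  obtain ⟨n, hn⟩ := hV.exists_genBelow
  exact exists_shift_projective_of_genBelow n V hn

end ShiftProjective

end FIPowModule

namespace FIPowModule

variable {k : Type u} [Field k] {m : ℕ} {U V C : FIPowModule k m}

/-! ### Elements of finite direct sums -/

section Biproduct

variable {ι : Type} [Finite ι] (F : ι → FIPowModule k m)

theorem sum_ι_π_apply {ι : Type} [Fintype ι] (F : ι → FIPowModule k m) (d : FIPow m)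
    (x : (⨁ F).obj d) :
    ∑ i, ((biproduct.ι F i).app d).hom (((biproduct.π F i).app d).hom x) = x := by
  have := app_congr (biproduct.total (f := F)) d x
  rw [NatTrans.app_sum, ModuleCat.hom_sum, LinearMap.sum_apply] at this
  exact this

theorem biproduct_apply_ext {d : FIPow m} {x y : (⨁ F).obj d}
    (h : ∀ i, ((biproduct.π F i).app d).hom x = ((biproduct.π F i).app d).hom y) : x = y := by
  have := Fintype.ofFinite ι
  rw [← sum_ι_π_apply F d x, ← sum_ι_π_apply F d y]
  simp only [h]

theorem π_ι_self_apply {d : FIPow m} (i : ι) (x : (F i).obj d) :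
    ((biproduct.π F i).app d).hom (((biproduct.ι F i).app d).hom x) = x :=
  app_congr (biproduct.ι_π_self F i) d x

theorem π_fromSubtype_apply (p : ι → Prop) {d : FIPow m} (y : (⨁ Subtype.restrict p F).obj d)
    {i : ι} (hi : p i) :
    ((biproduct.π F i).app d).hom (((biproduct.fromSubtype F p).app d).hom y) =
      ((biproduct.π (Subtype.restrict p F) ⟨i, hi⟩).app d).hom y := by
  classical
  exact app_congr ((biproduct.fromSubtype_π F p i).trans (dif_pos hi)) d y

theorem π_fromSubtype_apply_of_not (p : ι → Prop) {d : FIPow m}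
    (y : (⨁ Subtype.restrict p F).obj d) {i : ι} (hi : ¬ p i) :
    ((biproduct.π F i).app d).hom (((biproduct.fromSubtype F p).app d).hom y) = 0 := by
  classical
  exact app_congr ((biproduct.fromSubtype_π F p i).trans (dif_neg hi)) d y

theorem exists_fromSubtype_eq (p : ι → Prop) {d : FIPow m} (x : (⨁ F).obj d)
    (hx : ∀ i, ¬ p i → ((biproduct.π F i).app d).hom x = 0) :
    ∃ y, ((biproduct.fromSubtype F p).app d).hom y = x := by
  refine ⟨((biproduct.toSubtype F p).app d).hom x, biproduct_apply_ext F fun i => ?_⟩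
  by_cases hi : p i
  · rw [π_fromSubtype_apply F p _ hi]
    exact app_congr (biproduct.toSubtype_π F p ⟨i, hi⟩) d x
  · rw [π_fromSubtype_apply_of_not F p _ hi, hx i hi]

end Biproduct

/-! ### Finitely generated projective modules are filtered -/

section Filtered

theorem mem_filtrationStep_iff {g : ℕ} {c : Fin g → FIPow m} (P : (⨁ fun i => free k (c i)) ⟶ V)
    (r : ℕ) (d : FIPow m) (w : V.obj d) :
    w ∈ (filtrationStep P r).carrier d ↔
      ∃ x, (∀ i : Fin g, ¬ (i : ℕ) < r →
        ((biproduct.π (fun i => free k (c i)) i).app d).hom x = 0) ∧ (P.app d).hom x = w := by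
  constructor
  · rintro ⟨y, rfl⟩
    exact ⟨_, fun i hi => π_fromSubtype_apply_of_not _ (fun i : Fin g => (i : ℕ) < r) y hi, rfl⟩
  · rintro ⟨x, hx, rfl⟩
    obtain ⟨y, rfl⟩ := exists_fromSubtype_eq (fun i => free k (c i))
      (fun i : Fin g => (i : ℕ) < r) x hx
    exact ⟨y, rfl⟩

variable [CharZero k]

/-- If `W` is projective and generated by finitely many elements, the quotient by the submodule
generated by all but one of them, of maximal degree, is projective. -/
theorem projective_of_ker_eq {ι : Type} [Finite ι] {c : ι → FIPow m} (i₀ : ι)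
    (hc : ∀ i, (c i).deg ≤ (c i₀).deg) {W Q : FIPowModule k m} [Projective W]
    {p : (⨁ fun i => free k (c i)) ⟶ W} (hp : Surj p) {g : W ⟶ Q} (hg : Surj g)
    (hker : ∀ d w, (g.app d).hom w = 0 ↔
      ∃ y, ((biproduct.π (fun i => free k (c i)) i₀).app d).hom y = 0 ∧ (p.app d).hom y = w) :
    Projective Q := by
  have := Fintype.ofFinite ι
  let F : ι → FIPowModule k m := fun i => free k (c i)
  let i : free k (c i₀) ⟶ ⨁ F := biproduct.ι F i₀
  let q : (⨁ F) ⟶ free k (c i₀) := biproduct.π F i₀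
  have hqi : ∀ d x, (q.app d).hom ((i.app d).hom x) = x := fun d x => π_ι_self_apply F i₀ x
  have hker' : ∀ d x, ((i ≫ p ≫ g).app d).hom x = 0 ↔
      ∃ y, (q.app d).hom y = 0 ∧ (p.app d).hom y = (p.app d).hom ((i.app d).hom x) := fun d x =>
    hker d _
  obtain ⟨σ, hσ⟩ := exists_section hp
  have hpσ : ∀ d x, (p.app d).hom ((σ.app d).hom x) = x := fun d x => app_congr hσ d x
  refine projective_of_pull_mem (π := i ≫ p ≫ g) (fun d w => ?_) fun d φ x hx => ?_
  · obtain ⟨w, rfl⟩ := hg d w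
    obtain ⟨y, rfl⟩ := hp d w
    refine ⟨(q.app d).hom y, ?_⟩
    rw [comp_app_apply, comp_app_apply, ← sub_eq_zero, ← map_sub, ← map_sub, hker]
    exact ⟨_, by rw [map_sub]; exact sub_eq_zero.2 (hqi d _), rfl⟩
  · rw [hker'] at hx ⊢
    obtain ⟨y, hqy, hpy⟩ := hx
    let z := (i.app d).hom x - y
    have hpz : (p.app d).hom z = 0 := by rw [map_sub, hpy, sub_self]
    -- Restricting `z` summand by summand may leave the kernel of `p`, so `ζ` is corrected by the
    -- projection `1 - pσ` onto that kernel. The component in `M(c i₀)` is still `pull φ x`: by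
    -- maximality of the degree of `c i₀`, every morphism from the sum to `M(c i₀)` commutes with
    -- restriction, and `1 - pσ` fixes `z`.
    let ζ : (⨁ F).obj (c i₀) :=
      ∑ j, ((biproduct.ι F j).app _).hom (pull φ (((biproduct.π F j).app d).hom z))
    have hζ : ∀ θ : (⨁ F) ⟶ free k (c i₀), (θ.app _).hom ζ = pull φ ((θ.app d).hom z) := by
      intro θ
      conv_rhs => rw [← sum_ι_π_apply F d z]
      rw [map_sum, map_sum, map_sum]
      exact Finset.sum_congr rfl fun j _ => app_pull (hc j) (biproduct.ι F j ≫ θ) φ _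
    let z' := ζ - (σ.app _).hom ((p.app _).hom ζ)
    have hpz' : (p.app _).hom z' = 0 := by rw [map_sub, hpσ, sub_self]
    have hqz' : (q.app _).hom z' = pull φ x := by
      refine (hζ ((𝟙 _ - p ≫ σ) ≫ q)).trans (congrArg (pull φ) ?_)
      change (q.app d).hom (z - (σ.app d).hom ((p.app d).hom z)) = x
      rw [hpz, map_zero, sub_zero, map_sub, hqi, hqy, sub_zero]
    refine ⟨(i.app _).hom (pull φ x) - z', ?_, ?_⟩
    · rw [map_sub, hqi, hqz', sub_self]
    · rw [map_sub, hpz', sub_zero]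

/-- Descending induction from `W g = V`. If `W (r + 1)` is projective, its last generator has
maximal degree, so the quotient by `W r` is projective; the quotient map then splits, and `W r` is
projective as well. -/
theorem Generates.isFiltered [Projective V] {g : ℕ} {c : Fin g → FIPow m} {v : ∀ i, V.obj (c i)}
    (hv : Generates c v) (hc : Monotone fun i => (c i).deg) : IsFiltered V := by
  let P : (⨁ fun i => free k (c i)) ⟶ V := familyLift c v
  have hP : Surj P := hv.surj_familyLift
  let W : ℕ → Sub V := filtrationStep P
  have hW : ∀ r d, (W r).carrier d ≤ (W (r + 1)).carrier d := by
    intro r d w hw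
    obtain ⟨x, hx, rfl⟩ := (mem_filtrationStep_iff P r d w).1 hw
    exact (mem_filtrationStep_iff P _ d _).2 ⟨x, fun i hi => hx i fun h => hi (by omega), rfl⟩
  let S : ∀ r, Sub (W (r + 1)).toModule := fun r => (W r).comap (W (r + 1)).incl
  let mk : ∀ r, (W (r + 1)).toModule ⟶ subquotient (W (r + 1)) (W r) := fun r =>
    { app := fun d => ModuleCat.ofHom (Submodule.mkQ _)
      naturality := fun _ _ _ => rfl }
  have hmk : ∀ r, (S r).IsQuotient (mk r) := fun r =>
    ⟨fun d => Submodule.mkQ_surjective _, fun d x => Submodule.Quotient.mk_eq_zero _⟩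
  have hQ : ∀ r < g, Projective (W (r + 1)).toModule →
      Projective (subquotient (W (r + 1)) (W r)) := by
    intro r hr _
    let p : (⨁ Subtype.restrict (fun i : Fin g => (i : ℕ) < r + 1) fun i => free k (c i)) ⟶
        (W (r + 1)).toModule :=
      (W (r + 1)).lift (biproduct.fromSubtype (fun i => free k (c i)) _ ≫ P) fun d x => ⟨x, rfl⟩
    have hp : Surj p := by
      rintro d ⟨_, y, rfl⟩
      exact ⟨y, rfl⟩
    refine projective_of_ker_eq (c := fun i : {i : Fin g // (i : ℕ) < r + 1} => c i.1)
      ⟨⟨r, hr⟩, Nat.lt_succ_self r⟩ (fun i => hc (Fin.mk_le_mk.2 (Nat.lt_succ_iff.1 i.2)))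
      (p := p) hp (hmk r).surj fun d w => ?_
    refine ((hmk r).ker d w).trans ((mem_filtrationStep_iff P r d w.1).trans ⟨?_, ?_⟩)
    · rintro ⟨x, hx, hxw⟩
      obtain ⟨y, rfl⟩ := exists_fromSubtype_eq (fun i => free k (c i))
        (fun i : Fin g => (i : ℕ) < r + 1) x fun i hi => hx i fun h => hi (by omega)
      exact ⟨y, (π_fromSubtype_apply (fun i => free k (c i)) (fun i : Fin g => (i : ℕ) < r + 1) y
        (i := ⟨r, hr⟩) (Nat.lt_succ_self r)).symm.trans (hx ⟨r, hr⟩ (lt_irrefl r)),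
        Subtype.ext hxw⟩
    · rintro ⟨y, hy, rfl⟩
      refine ⟨((biproduct.fromSubtype (fun i => free k (c i)) _).app d).hom y, fun i hi => ?_, rfl⟩
      by_cases hir : (i : ℕ) < r + 1
      · obtain rfl : i = ⟨r, hr⟩ := Fin.ext (by simp only; omega)
        exact (π_fromSubtype_apply (fun i => free k (c i)) (fun i : Fin g => (i : ℕ) < r + 1) y
          hir).trans hy
      · exact π_fromSubtype_apply_of_not (fun i => free k (c i))
          (fun i : Fin g => (i : ℕ) < r + 1) y hir
  have hproj : ∀ r ≤ g, Projective (W r).toModule := by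
    intro r hr
    induction hr using Nat.decreasingInduction with
    | self =>
      refine projective_of_retract (V := V) (W g).incl ((W g).lift (𝟙 V) fun d x => ?_) rfl
      obtain ⟨y, rfl⟩ := hP d x
      exact (mem_filtrationStep_iff P g d _).2 ⟨y, fun i hi => absurd i.2 hi, rfl⟩
    | of_succ r hr ih =>
      have := hQ r hr ih
      have : Projective (S r).toModule := (hmk r).projective_sub
      refine projective_of_retract (V := (S r).toModule)
        ((S r).lift ((W (r + 1)).lift (W r).incl fun d x => hW r d x.2) fun d x => x.2)
        ((W r).lift ((S r).incl ≫ (W (r + 1)).incl) fun d x => x.2) rfl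
  exact ⟨g, c, P, hP, fun r hr => hQ r hr (hproj (r + 1) hr)⟩

theorem Generates.isFiltered_of_finite [Projective V] {ι : Type} [Finite ι] {c : ι → FIPow m}
    {v : ∀ i, V.obj (c i)} (hv : Generates c v) : IsFiltered V := by
  obtain ⟨g, ⟨e⟩⟩ := Finite.exists_equiv_fin ι
  let s := Tuple.sort fun j => (c (e.symm j)).deg
  exact (hv.of_surjective (e := fun j => e.symm (s j))
    (e.symm.surjective.comp s.surjective)).isFiltered
      (Tuple.monotone_sort fun j => (c (e.symm j)).deg)

end Filtered

/-! ### Generators of a shift, and injectivity of `V → S_{+a}V` in large degrees -/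

section Shift

theorem Generates.exists_generates_shift {ι : Type} [Finite ι] {c : ι → FIPow m}
    {v : ∀ i, V.obj (c i)} (hv : Generates c v) (a : FIPow m) :
    ∃ (κ : Type) (_ : Finite κ) (c' : κ → FIPow m) (v' : ∀ i, (shift a V).obj (c' i)),
      Generates c' v' := by
  let κ : Type := Σ i, Σ s : ∀ j, Set ((c i) j).carrier, (c i ⟶ FIPow.add (FIPow.ofSets s) a)
  let v' : ∀ p : κ, (shift a V).obj (FIPow.ofSets p.2.1) := fun p => (V.map p.2.2).hom (v p.1)
  have hκ : Finite κ := inferInstance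
  refine ⟨κ, hκ, fun p => FIPow.ofSets p.2.1, v', fun d => ?_⟩
  let T := (spanSub (V := shift a V) (fun p : κ => FIPow.ofSets p.2.1) v').carrier d
  suffices ∀ x ∈ (spanSub c v).carrier (FIPow.add d a), x ∈ T from
    eq_top_iff.2 fun x _ => this x (hv (FIPow.add d a) ▸ Submodule.mem_top)
  intro x hx
  induction hx using Submodule.span_induction with
  | mem x hx =>
    obtain ⟨⟨i, f⟩, rfl⟩ := hx
    obtain ⟨s, h₀, g, -, rfl⟩ := FIPow.exists_canonical f
    exact Submodule.subset_span ⟨⟨⟨i, s, h₀⟩, g⟩, (map_comp_apply V h₀ (FIPow.addMap g a) _).symm⟩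
  | zero => exact T.zero_mem
  | add x y _ _ hx hy => exact T.add_mem hx hy
  | smul r x _ hx => exact T.smul_mem r hx

/-- A projective module embeds in the free module covering it, where injections act injectively on
basis elements. -/
theorem Generates.map_injective [Projective V] {ι : Type} [Finite ι] {c : ι → FIPow m}
    {v : ∀ i, V.obj (c i)} (hv : Generates c v) {d e : FIPow m} (f : d ⟶ e) :
    Function.Injective (V.map f).hom := by
  obtain ⟨s, hs⟩ := exists_section hv.surj_familyLift
  have hs' : Function.Injective (s.app d).hom :=
    Function.LeftInverse.injective (g := ((familyLift c v).app d).hom) fun x => app_congr hs d x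
  intro x y hxy
  refine hs' (biproduct_apply_ext _ fun i => free_map_injective f ?_)
  rw [← app_map, ← app_map, ← app_map, ← app_map, hxy]

/-- Write `e` as `d + a`. Up to exchanging the two copies of `a` in `(d + a) + a`, the inclusion `e
→ e + a` becomes the morphism `d → d + a` shifted by `a`, on which `ha` applies. -/
theorem toShift_app_injective {a : FIPow m}
    (ha : ∀ {d e : FIPow m} (f : d ⟶ e), Function.Injective ((shift a V).map f).hom) {e : FIPow m}
    (he : a.card ≤ e.card) : Function.Injective ((toShift a V).app e).hom := by
  have hcard : ∀ i, Nonempty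
      ((Fin (Nat.card (e i).carrier - Nat.card (a i).carrier) ⊕ (a i).carrier) ≃ (e i).carrier) := by
    intro i
    refine Finite.card_eq.1 ?_
    rw [Nat.card_sum, Nat.card_fin]
    exact Nat.sub_add_cancel (he i)
  let d : FIPow m := fun i => ⟨Fin (Nat.card (e i).carrier - Nat.card (a i).carrier)⟩
  let ψ : FIPow.add d a ≅ e := FIPow.isoMk fun i => (hcard i).some
  let ζ : FIPow.add e a ⟶ FIPow.add (FIPow.add d a) a :=
    FIPow.addMap ψ.inv a ≫ (FIPow.addSwapIso a a).hom.app d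
  have key : ψ.hom ≫ FIPow.inl e a ≫ ζ = FIPow.addMap (FIPow.inl d a) a := by
    have : ψ.hom ≫ FIPow.inl e a ≫ ζ =
        (ψ.hom ≫ ψ.inv) ≫ FIPow.inl _ a ≫ (FIPow.addSwapIso a a).hom.app d := rfl
    rw [this, ψ.hom_inv_id, Category.id_comp]
    refine FIPow.hom_ext fun i x => ?_
    rcases x with x | x <;> rfl
  have hinj : Function.Injective (V.map (ψ.hom ≫ FIPow.inl e a ≫ ζ)).hom := by
    rw [key]
    exact ha (FIPow.inl d a)
  intro x y hxy
  have hψ : ∀ x, (V.map ψ.hom).hom ((V.map ψ.inv).hom x) = x := fun x => by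
    rw [← map_comp_apply, ψ.inv_hom_id, map_id_apply]
  have hζ : ∀ x, (V.map (ψ.hom ≫ FIPow.inl e a ≫ ζ)).hom ((V.map ψ.inv).hom x) =
      (V.map ζ).hom (((toShift a V).app e).hom x) := fun x => by
    rw [map_comp_apply, hψ, map_comp_apply V (FIPow.inl e a)]
    rfl
  rw [← hψ x, ← hψ y]
  exact congrArg _ (hinj (by rw [hζ, hζ, hxy]))

end Shift

/-! ### The complex of filtered modules -/

section Resolution

/-- There is a finite complex `0 → V → J⁰ → J¹ → ⋯` of filtered modules that is exact in all
sufficiently large degrees. -/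
def HasFilteredResolution (V : FIPowModule k m) : Prop :=
  ∃ (N : ℕ) (J : CochainComplex (FIPowModule k m) ℕ) (ε : V ⟶ J.X 0),
    (∀ i ≤ N, FIPowModule.IsFiltered (J.X i)) ∧
    (∀ i, N < i → IsZero (J.X i)) ∧
    ε ≫ J.d 0 1 = 0 ∧
    ∃ D : Fin m → ℕ, ∀ d : FIPow m, D ≤ FIPow.card d →
      Function.Injective (ε.app d) ∧
      Function.Exact (ε.app d) ((J.d 0 1).app d) ∧
      ∀ i, Function.Exact ((J.d i (i + 1)).app d) ((J.d (i + 1) (i + 2)).app d)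

/-- The resolution of the cokernel is spliced behind `X`. Exactness at `X` uses that its
augmentation is injective in large degrees, and exactness one step later that `X` surjects onto the
cokernel. -/
theorem HasFilteredResolution.of_coker {X : FIPowModule k m} (hX : IsFiltered X) (η : V ⟶ X)
    (hη : ∃ D : Fin m → ℕ, ∀ d : FIPow m, D ≤ FIPow.card d → Function.Injective (η.app d).hom)
    (h : HasFilteredResolution (range η).quot) : HasFilteredResolution V := by
  obtain ⟨N, J, ε, hF, hZ, hε, D, hD⟩ := h
  obtain ⟨D', hD'⟩ := hη
  have hQ := (range η).isQuotient_mkQ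
  have hηmk : η ≫ (range η).mkQ = 0 := hom_ext fun d x => (hQ.ker d _).2 ⟨x, rfl⟩
  have hw : ((range η).mkQ ≫ ε) ≫ J.d 0 1 = 0 := by rw [Category.assoc, hε, comp_zero]
  refine ⟨N + 1, CochainComplex.augment J ((range η).mkQ ≫ ε) hw, η, ?_, ?_, ?_, D ⊔ D', ?_⟩
  · rintro (_ | i) hi
    · exact hX
    · exact hF i (by omega)
  · rintro (_ | i) hi
    · omega
    · exact hZ i (by omega)
  · change η ≫ (range η).mkQ ≫ ε = 0
    rw [← Category.assoc, hηmk, zero_comp]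
  · intro d hd
    obtain ⟨h₁, h₂, h₃⟩ := hD d (le_sup_left.trans hd)
    refine ⟨hD' d (le_sup_right.trans hd), fun y => ?_, ?_⟩
    · change (ε.app d).hom (((range η).mkQ.app d).hom y) = 0 ↔ _
      exact (map_eq_zero_iff _ h₁).trans (hQ.ker d y)
    · rintro (_ | i)
      · intro y
        refine (h₂ y).trans ⟨?_, ?_⟩
        · rintro ⟨z, rfl⟩
          obtain ⟨x, rfl⟩ := hQ.surj d z
          exact ⟨x, rfl⟩
        · rintro ⟨x, rfl⟩
          exact ⟨((range η).mkQ.app d).hom x, rfl⟩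
      · exact h₃ i

variable [CharZero k]

theorem Generates.hasFilteredResolution_of_isEmpty {ι : Type} [IsEmpty ι] {c : ι → FIPow m}
    {v : ∀ i, V.obj (c i)} (hv : Generates c v) : HasFilteredResolution V := by
  have h0 := hv.eq_zero
  have : Projective V := projective_of_forall_eq_zero h0
  have hF : IsFiltered V := hv.isFiltered_of_finite
  have hZ : IsZero V := (IsZero.iff_id_eq_zero V).2 (hom_ext fun d x => (h0 d _).trans (h0 d _).symm)
  -- As V is zero, the constant complex on V serves as the zero complex.
  refine ⟨0, { X := fun _ => V, d := fun _ _ => 0 }, 𝟙 V, fun _ _ => hF, fun _ _ => hZ,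
    comp_zero, 0, fun d _ => ⟨fun x y _ => (h0 d x).trans (h0 d y).symm, fun y => ?_,
      fun i y => ?_⟩⟩
  · exact ⟨fun _ => ⟨y, rfl⟩, fun _ => rfl⟩
  · exact ⟨fun _ => ⟨y, (h0 d _).trans (h0 d y).symm⟩, fun _ => rfl⟩

/-- The cokernel of `V → S_{+a}V` is a quotient of `newPart`, so its generation bound is smaller by
one and the process stops at the zero module. -/
theorem hasFilteredResolution_of_genBelow (n : ℕ) (V : FIPowModule k m) (hV : GenBelow n V) :
    HasFilteredResolution V := by
  induction n generalizing V with
  | zero =>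
    obtain ⟨ι, -, c, v, hv, hc⟩ := hV
    have : IsEmpty ι := ⟨fun i => Nat.not_lt_zero _ (hc i)⟩
    exact hv.hasFilteredResolution_of_isEmpty
  | succ n ih =>
    obtain ⟨a, ha⟩ := exists_shift_projective_of_genBelow _ V hV
    obtain ⟨ι, hι, c, v, hv, hc⟩ := hV
    obtain ⟨κ, hκ, c', v', hv'⟩ := hv.exists_generates_shift a
    refine HasFilteredResolution.of_coker hv'.isFiltered_of_finite (toShift a V)
      ⟨a.card, fun d hd => toShift_app_injective (fun f => hv'.map_injective f) hd⟩ (ih _ ?_)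
    have hQ := (range (toShift a V)).isQuotient_mkQ
    refine (genBelow_newPart v hc a).of_surj
      (g := (newPart c v a).incl ≫ (range (toShift a V)).mkQ) fun d q => ?_
    obtain ⟨x, rfl⟩ := hQ.surj d q
    obtain ⟨y, hy, z, rfl⟩ := hv.exists_add_of_shift a d x
    refine ⟨⟨y, hy⟩, ?_⟩
    have hz := (hQ.ker d (((toShift a V).app d).hom z)).2 ⟨z, rfl⟩
    exact ((map_add ((range (toShift a V)).mkQ.app d).hom y _).trans
      ((congrArg (_ + ·) hz).trans (add_zero _))).symm

end Resolution

end FIPowModule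

end

theorem theorem2p5 {k : Type u} [Field k] [CharZero k] (m : ℕ) (V : FIPowModule k m)
    (hV : FIPowModule.IsFinitelyGenerated V) :
    (∃ a : FIPow m, FIPowModule.IsFiltered (FIPowModule.shift a V)) ∧
      ∃ (N : ℕ) (J : CochainComplex (FIPowModule k m) ℕ) (ε : V ⟶ J.X 0),
        (∀ i ≤ N, FIPowModule.IsFiltered (J.X i)) ∧
        (∀ i, N < i → IsZero (J.X i)) ∧
        ε ≫ J.d 0 1 = 0 ∧
        ∃ D : Fin m → ℕ, ∀ d : FIPow m, D ≤ FIPow.card d →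
          Function.Injective (ε.app d) ∧
          Function.Exact (ε.app d) ((J.d 0 1).app d) ∧
          ∀ i, Function.Exact ((J.d i (i + 1)).app d) ((J.d (i + 1) (i + 2)).app d) := by
  obtain ⟨n, hn⟩ := hV.exists_genBelow
  refine ⟨?_, FIPowModule.hasFilteredResolution_of_genBelow n V hn⟩
  obtain ⟨a, ha⟩ := FIPowModule.exists_shift_projective_of_genBelow n V hn
  obtain ⟨ι, hι, c, v, hv, -⟩ := hn
  obtain ⟨κ, hκ, c', v', hv'⟩ := hv.exists_generates_shift a
  exact ⟨a, hv'.isFiltered_of_finite⟩
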